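/- Let $f\in\mathbb{C}[z_1,\dots,z_n]$ be a polynomial without multiple factors (squarefree), and let $V=\{z\in\mathbb{C}^n : f(z)=0\}$, an algebraic hypersurface, possibly singular and/or reducible. Let $R(V)$ be the complex manifold of regular points of $V$ (the points of $V$ at which $df\neq 0$), and let $R_i$ be its connected components. Fix a basepoint $*\in\mathbb{C}^n-V$. For each $i$ choose a point of $R_i$, a smoothly embedded oriented closed $2$-disk $D_i\subset\mathbb{C}^n$ which meets $V$ only at that point, and there transversely and positively with respect to the complex orientations of $R(V)$ and $\mathbb{C}^n$, and an arc $a_i$ in $\mathbb{C}^n-V$ from $*$ to a point of the boundary $\partial D_i$. Let $l_i$ be the loop which runs from $*$ along $a_i$ to $\partial D_i$, once around $\partial D_i$ counterclockwise, and back along $a_i$ to $*$. An element of $\pi_1(\mathbb{C}^n-V;*)$ is called quasipositive if it is a finite (possibly empty) product $\prod_{j=1}^m w_j\,[l_{i(j)}]\,w_j^{-1}$ of conjugates of the classes $[l_i]$; quasipositivity is invariant under conjugation. Let $\varphi$ be an analytic disk in $\mathbb{C}^n$, that is, a map of the closed unit disk to $\mathbb{C}^n$ which is the restriction of a complex analytic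 map on some larger open disk $\{|t|<R\}$, $R>1$, and suppose that $\varphi(S^1)\cap V=\emptyset$. Then, for every such choice of the loops $l_i$, the analytic loop $\varphi|_{S^1}$, with $S^1$ oriented counterclockwise, represents a quasipositive conjugacy class in $\pi_1(\mathbb{C}^n-V;*)$: every element of the conjugacy class that it represents is quasipositive. -/

import Mathlib

open scoped ContDiff

noncomputable section

/-- The affine hypersurface `V_f = {z ∈ ℂⁿ | f z = 0}`. -/
def hypersurface {n : ℕ} (f : MvPolynomial (Fin n) ℂ) : Set (Fin n → ℂ) :=
  {z | MvPolynomial.eval z f = 0}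

/-- The complement `ℂⁿ - V_f`. -/
abbrev HypersurfaceCompl {n : ℕ} (f : MvPolynomial (Fin n) ℂ) : Type :=
  ((hypersurface f)ᶜ : Set (Fin n → ℂ))

/-- The complex differential `df_p : ℂⁿ → ℂ` of `f` at `p`, `v ↦ ∑ j, ∂f/∂z_j (p) * v_j`. -/
def polyDifferential {n : ℕ} (f : MvPolynomial (Fin n) ℂ) (p : Fin n → ℂ) :
    (Fin n → ℂ) →L[ℂ] ℂ :=
  ∑ j, MvPolynomial.eval p (MvPolynomial.pderiv j f) • ContinuousLinearMap.proj j

/-- The regular points `R(V_f)` of the hypersurface (for `f` without multiple factors): the points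
of `V_f` at which the differential of `f` does not vanish. -/
def regularPoints {n : ℕ} (f : MvPolynomial (Fin n) ℂ) : Set (Fin n → ℂ) :=
  {p | p ∈ hypersurface f ∧ polyDifferential f p ≠ 0}

/-- The restriction of `φ : ℂ → E` to the unit circle, run once counterclockwise from `φ 1`, as a
loop in a subset `X` of `E` which contains the image of the circle. -/
def circleLoop {E : Type*} [TopologicalSpace E] (X : Set E) (φ : ℂ → E)
    (hφ : ContinuousOn φ (Metric.sphere 0 1)) (hX : ∀ z ∈ Metric.sphere (0 : ℂ) 1, φ z ∈ X) :
    Path (⟨φ 1, hX 1 (by simp)⟩ : X) ⟨φ 1, hX 1 (by simp)⟩ where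
  toFun t := ⟨φ (Circle.exp (2 * Real.pi * (t : ℝ))), hX _ (mem_sphere_zero_iff_norm.2 (Circle.norm_coe _))⟩
  continuous_toFun := by
    refine Continuous.subtype_mk (hφ.comp_continuous (by fun_prop) fun t =>
      mem_sphere_zero_iff_norm.2 (Circle.norm_coe _)) _
  source' := by simp
  target' := by simp

/-- An analytic disk in `ℂⁿ`: a map on the closed unit disk which is complex analytic on some
slightly larger open disk. (Values of `φ` elsewhere are irrelevant.) -/
def IsAnalyticDisk {n : ℕ} (φ : ℂ → Fin n → ℂ) : Prop :=
  ∃ R : ℝ, 1 < R ∧ AnalyticOnNhd ℂ φ (Metric.ball 0 R)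

theorem IsAnalyticDisk.continuousOn_sphere {n : ℕ} {φ : ℂ → Fin n → ℂ} (h : IsAnalyticDisk φ) :
    ContinuousOn φ (Metric.sphere 0 1) := by
  obtain ⟨R, hR, hφ⟩ := h
  exact hφ.continuousOn.mono
    (Metric.sphere_subset_closedBall.trans (Metric.closedBall_subset_ball hR))

/-- The analytic loop in `ℂⁿ - V_f` which is the oriented boundary of an analytic disk in `ℂⁿ`
whose boundary does not meet `V_f`. -/
def analyticLoop {n : ℕ} (f : MvPolynomial (Fin n) ℂ) (φ : ℂ → Fin n → ℂ) (hφ : IsAnalyticDisk φ)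
    (hV : ∀ z : ℂ, ‖z‖ = 1 → φ z ∉ hypersurface f) :
    Path (⟨φ 1, hV 1 (by simp)⟩ : HypersurfaceCompl f) ⟨φ 1, hV 1 (by simp)⟩ :=
  circleLoop (hypersurface f)ᶜ φ hφ.continuousOn_sphere fun z hz => hV z (by simpa using hz)

/-- An oriented (smoothly embedded, parametrized) closed normal `2`-disk to `V_f` at the point `p`
of `V_f`, which meets `V_f` only at `p`, and there transversely and positively.

The tangent space of `V_f` at a regular point `p` is the kernel of `df_p`, so that `df_p` identifies
the normal space `ℂⁿ / T_p V_f`, with its complex orientation, with `ℂ`. Hence the disk is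
transverse to `V_f` at `p`, with positive intersection, iff the real-linear map
`df_p ∘ dφ_0 : ℂ → ℂ` preserves orientation. -/
structure PositiveNormalDisk {n : ℕ} (f : MvPolynomial (Fin n) ℂ) (p : Fin n → ℂ) where
  /-- the parametrization, of which only the restriction to the closed unit disk matters -/
  toFun : ℂ → Fin n → ℂ
  smooth : ∃ R : ℝ, 1 < R ∧ ContDiffOn ℝ ∞ toFun (Metric.ball 0 R)
  injOn : Set.InjOn toFun (Metric.closedBall 0 1)
  immersion : ∀ z ∈ Metric.closedBall (0 : ℂ) 1, Function.Injective (fderiv ℝ toFun z)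
  center : toFun 0 = p
  mem_iff : ∀ z ∈ Metric.closedBall (0 : ℂ) 1, toFun z ∈ hypersurface f ↔ z = 0
  positive : 0 < (((polyDifferential f p).restrictScalars ℝ).comp (fderiv ℝ toFun 0)).det

namespace PositiveNormalDisk

variable {n : ℕ} {f : MvPolynomial (Fin n) ℂ} {p : Fin n → ℂ}

theorem continuousOn_sphere (d : PositiveNormalDisk f p) :
    ContinuousOn d.toFun (Metric.sphere 0 1) := by
  obtain ⟨R, hR, h⟩ := d.smooth
  exact h.continuousOn.mono
    (Metric.sphere_subset_closedBall.trans (Metric.closedBall_subset_ball hR))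

theorem notMem_of_mem_sphere (d : PositiveNormalDisk f p) (z : ℂ)
    (hz : z ∈ Metric.sphere (0 : ℂ) 1) : d.toFun z ∈ (hypersurface f)ᶜ := by
  intro h
  rw [d.mem_iff z (Metric.sphere_subset_closedBall hz)] at h
  simp [h] at hz

/-- The point of the boundary of the disk at which its boundary loop starts. -/
def basePoint (d : PositiveNormalDisk f p) : HypersurfaceCompl f :=
  ⟨d.toFun 1, d.notMem_of_mem_sphere 1 (by simp)⟩

/-- The boundary of the disk, run once counterclockwise, as a loop in `ℂⁿ - V_f`. -/
def boundary (d : PositiveNormalDisk f p) : Path d.basePoint d.basePoint :=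
  circleLoop (hypersurface f)ᶜ d.toFun d.continuousOn_sphere d.notMem_of_mem_sphere

end PositiveNormalDisk

/-- The data defining a positive meridian loop, based at `b`, of the connected component `C` of the
manifold of regular points of `V_f`: a point of `C`, a positive normal disk there, and an arc in
`ℂⁿ - V_f` from `b` to the boundary of the disk. -/
structure Meridian {n : ℕ} (f : MvPolynomial (Fin n) ℂ) (b : HypersurfaceCompl f)
    (C : ConnectedComponents (regularPoints f)) where
  point : regularPoints f
  point_mem : ConnectedComponents.mk point = C
  disk : PositiveNormalDisk f (point : Fin n → ℂ)
  arc : Path b disk.basePoint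

/-- The meridian loop: along the arc, once counterclockwise around the boundary of the disk, and
back along the arc. -/
def Meridian.loop {n : ℕ} {f : MvPolynomial (Fin n) ℂ} {b : HypersurfaceCompl f}
    {C : ConnectedComponents (regularPoints f)} (l : Meridian f b C) : Path b b :=
  l.arc.trans (l.disk.boundary.trans l.arc.symm)

/-- The class of a based loop in the fundamental group. -/
def loopClass {X : Type*} [TopologicalSpace X] {b : X} (γ : Path b b) : FundamentalGroup X b :=
  FundamentalGroup.fromPath (Path.Homotopic.Quotient.mk γ)

/-- An element of the fundamental group is quasipositive, with respect to a choice of one meridian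
loop `l C` for each component `C` of the manifold of regular points of `V_f`, if it is a (finite,
possibly empty) product of conjugates `w * [l C] * w⁻¹`. (Since conjugators and the order of the
factors are arbitrary, the convention for the order of multiplication in the fundamental group does
not matter.) -/
def IsQuasipositive {n : ℕ} {f : MvPolynomial (Fin n) ℂ} {b : HypersurfaceCompl f}
    (l : ∀ C : ConnectedComponents (regularPoints f), Meridian f b C)
    (g : FundamentalGroup (HypersurfaceCompl f) b) : Prop :=
  ∃ L : List (FundamentalGroup (HypersurfaceCompl f) b × ConnectedComponents (regularPoints f)),
    g = (L.map fun q => q.1 * loopClass (l q.2).loop * q.1⁻¹).prod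

/-- The loop `γ`, based at any point `x`, represents the conjugacy class `c` in `π₁(X, b)`: for
some path `α` from `b` to `x`, the class `c` is that of the based loop `α γ α⁻¹`. -/
def RepresentsConjClass {X : Type*} [TopologicalSpace X] {x : X} (γ : Path x x) {b : X}
    (c : ConjClasses (FundamentalGroup X b)) : Prop :=
  ∃ α : Path b x, ConjClasses.mk (loopClass (α.trans (γ.trans α.symm))) = c

end

/-!
The boundary of an analytic disk which is transverse to the hypersurface `V = {f = 0}` and meets it
in regular points only is, by cutting the disk into small pieces, a product of conjugates of the
boundaries of small disks around the intersection points. As complex intersections are positive,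
these are positive meridians of `V`. Two observations reduce the theorem to this.

* Transversality. Approximate the disk on the unit circle by a polynomial one, `P : ℂ → ℂⁿ`, and
  then by a translate `P + d` with `d ∈ ℂⁿ` small and generic. Since `f` is squarefree, so is
  `f (P(t) + d)` as a polynomial in `t` and `d`; hence, by Gauss's lemma and a Bézout identity with
  its `t`-derivative, it has only simple zeros in `t` for generic `d` (`exists_generic_translate`).
  At a simple zero of `f ∘ (P + d)` the differential of `f` cannot vanish, so no dimension count for
  the singular locus is needed. The boundary loop changes by a small homotopy in the complement.
* Uniqueness of meridians. Near a regular point, the implicit function theorem turns `f` into a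
  coordinate function, so that loops close to the point are classified, up to free homotopy in the
  complement, by their image under `f` in `ℂ - 0` (`exists_local_homotopy`). Positivity of a normal
  disk says that this image winds once around `0`. Consequently the set of regular points whose
  small meridians are quasipositive is open and closed in `R(V)` (`isClopen_meridiansMem`), and
  contains all of it as soon as it meets every component.

The bookkeeping is done with families of loops closed under products and conjugation
(`NormalLoops`), membership in which depends on free homotopy classes only. The disk is cut in
logarithmic coordinates, where an annulus becomes a rectangle, and rectangles with finitely many
punctures are cut by horizontal and vertical lines (`RectBoundaryIn.mem_loopClass_of_finite`).
-/

/-! ### Loops, free homotopies and straight paths -/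

noncomputable section

open Path unitInterval

namespace Path.Homotopic.Quotient

variable {X Y : Type*} [TopologicalSpace X] [TopologicalSpace Y] {x y z : X}

theorem symm_symm (a : Homotopic.Quotient x y) : a.symm.symm = a := by
  induction a using Quotient.ind with | mk a => simp [← mk_symm]

theorem symm_trans_distrib (a : Homotopic.Quotient x y) (b : Homotopic.Quotient y z) :
    (a.trans b).symm = b.symm.trans a.symm := by
  induction a using Quotient.ind with | mk a =>
  induction b using Quotient.ind with | mk b =>
  simp [← mk_symm, ← mk_trans, Path.trans_symm]

theorem symm_trans_trans (a : Homotopic.Quotient x y) (b : Homotopic.Quotient y z) :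
    a.symm.trans (a.trans b) = b := by
  rw [← trans_assoc, symm_trans, refl_trans]

theorem map_trans (a : Homotopic.Quotient x y) (b : Homotopic.Quotient y z) (h : C(X, Y)) :
    (a.trans b).map h = (a.map h).trans (b.map h) :=
  (FundamentalGroupoid.map h).map_comp (X := ⟨x⟩) (Y := ⟨y⟩) (Z := ⟨z⟩) a b

theorem map_symm (a : Homotopic.Quotient x y) (h : C(X, Y)) : a.symm.map h = (a.map h).symm := by
  induction a using Quotient.ind with | mk a => simp [← mk_symm, ← mk_map]

end Path.Homotopic.Quotient

/-- A family of (homotopy classes of) loops at all points of `X` which contains the trivial loops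
and is closed under products of loops with the same base point and under transport `a ↦ p a p⁻¹`
along paths `p`. In contrast to a normal subgroupoid it need not be closed under inverses, so that
for instance the quasipositive loops form such a family. -/
structure NormalLoops (X : Type*) [TopologicalSpace X] where
  mem : ∀ {x : X}, Homotopic.Quotient x x → Prop
  refl_mem : ∀ x : X, mem (Homotopic.Quotient.refl x)
  trans_mem : ∀ {x : X} {a b : Homotopic.Quotient x x}, mem a → mem b → mem (a.trans b)
  conj_mem : ∀ {x y : X} (p : Homotopic.Quotient x y) {a : Homotopic.Quotient y y}, mem a →
    mem (p.trans (a.trans p.symm))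

namespace NormalLoops

variable {X Y : Type*} [TopologicalSpace X] [TopologicalSpace Y]

theorem mem_of_conj (Q : NormalLoops X) {x y : X} (p : Homotopic.Quotient x y)
    {a : Homotopic.Quotient y y} (h : Q.mem (p.trans (a.trans p.symm))) : Q.mem a := by
  simpa [Homotopic.Quotient.symm_symm, Homotopic.Quotient.symm_trans_trans] using
    Q.conj_mem p.symm h

/-- The loops in `X` whose image under `h : X → Y` belongs to `Q`. -/
def comap (Q : NormalLoops Y) (h : C(X, Y)) : NormalLoops X where
  mem a := Q.mem (a.map h)
  refl_mem x := Q.refl_mem (h x)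
  trans_mem ha hb := by
    rw [Homotopic.Quotient.map_trans]
    exact Q.trans_mem ha hb
  conj_mem p a ha := by
    rw [Homotopic.Quotient.map_trans, Homotopic.Quotient.map_trans, Homotopic.Quotient.map_symm]
    exact Q.conj_mem _ ha

end NormalLoops

/-- The standard generator of the fundamental group of the circle, based at `1`. -/
def circlePath : Path (1 : Circle) 1 where
  toFun t := Circle.exp (2 * Real.pi * (t : ℝ))
  continuous_toFun := by fun_prop
  source' := by simp
  target' := by simp

namespace NormalLoops

variable {X : Type*} [TopologicalSpace X]

/-- The free loop `u`, read as a loop based at `u 1`, belongs to `Q`. -/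
def circleMem (Q : NormalLoops X) (u : C(Circle, X)) : Prop :=
  Q.mem (Homotopic.Quotient.mk (circlePath.map u.continuous))

/-- Membership depends on the free homotopy class only: a free homotopy conjugates one loop to the
other by the track of the base point. -/
theorem circleMem_of_homotopic (Q : NormalLoops X) {u v : C(Circle, X)} (h : u.Homotopic v)
    (hv : Q.circleMem v) : Q.circleMem u := by
  obtain ⟨F⟩ := h
  have key := Path.Homotopic.map_trans_evalAt F circlePath
  rw [← Homotopic.Quotient.eq] at key
  simp only [Homotopic.Quotient.mk_trans] at key
  have := Q.conj_mem (Homotopic.Quotient.mk (F.evalAt 1)) hv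
  rw [← Homotopic.Quotient.trans_assoc, ← key] at this
  simpa [circleMem] using this

theorem circleMem_const (Q : NormalLoops X) (x : X) :
    Q.circleMem (ContinuousMap.const Circle x) := by
  have : circlePath.map (ContinuousMap.const Circle x).continuous = Path.refl x := by
    ext; rfl
  rw [circleMem, this]
  exact Q.refl_mem x

end NormalLoops

section Convex

variable {E : Type*} [AddCommGroup E] [TopologicalSpace E] [IsTopologicalAddGroup E]
  [Module ℝ E] [ContinuousSMul ℝ E]

/-- Two paths with the same end points in a convex subset of `U` are homotopic in `U`, by the
straight-line homotopy. -/
theorem Path.homotopic_of_convex {U S : Set E} (hS : Convex ℝ S) (hSU : S ⊆ U) {p q : U}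
    (γ γ' : Path p q) (h : ∀ t, (γ t : E) ∈ S) (h' : ∀ t, (γ' t : E) ∈ S) : γ.Homotopic γ' :=
  ⟨{ toFun := fun x => ⟨AffineMap.lineMap (γ x.2 : E) (γ' x.2 : E) (x.1 : ℝ),
        hSU (hS.segment_subset (h _) (h' _) (lineMap_mem_segment ℝ _ _ x.1.2))⟩
     continuous_toFun := by
      refine Continuous.subtype_mk ?_ _
      simp only [AffineMap.lineMap_apply_module]
      fun_prop
     map_zero_left := by simp
     map_one_left := by simp
     prop' := by
      rintro t x (rfl | rfl) <;> simp }⟩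

/-- The homotopy class `a` of paths in `U` has a representative with values in `S`. -/
def Path.Homotopic.Quotient.Through {U : Set E} {p q : U} (a : Homotopic.Quotient p q) (S : Set E) : Prop :=
  ∃ γ : Path p q, Homotopic.Quotient.mk γ = a ∧ ∀ t, (γ t : E) ∈ S

namespace Path.Homotopic.Quotient.Through

section

variable {E : Type*} [TopologicalSpace E] {U S : Set E} {p q r : U}

theorem refl (hp : (p : E) ∈ S) : (Homotopic.Quotient.refl p).Through S :=
  ⟨Path.refl p, rfl, fun _ => hp⟩

theorem symm {a : Homotopic.Quotient p q} (h : a.Through S) : a.symm.Through S := by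
  obtain ⟨γ, rfl, hγ⟩ := h
  exact ⟨γ.symm, rfl, fun t => hγ _⟩

theorem trans {a : Homotopic.Quotient p q} {b : Homotopic.Quotient q r} (ha : a.Through S) (hb : b.Through S) :
    (a.trans b).Through S := by
  obtain ⟨γ, rfl, hγ⟩ := ha
  obtain ⟨γ', rfl, hγ'⟩ := hb
  refine ⟨γ.trans γ', rfl, fun t => ?_⟩
  rw [Path.trans_apply]
  split_ifs
  · exact hγ _
  · exact hγ' _

end

variable {U S : Set E} {p q : U}

theorem eq_of_convex (hS : Convex ℝ S) (hSU : S ⊆ U) {a b : Homotopic.Quotient p q}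
    (ha : a.Through S) (hb : b.Through S) : a = b := by
  obtain ⟨γ, rfl, hγ⟩ := ha
  obtain ⟨γ', rfl, hγ'⟩ := hb
  exact Homotopic.Quotient.eq.2 (Path.homotopic_of_convex hS hSU γ γ' hγ hγ')

end Path.Homotopic.Quotient.Through

/-- The straight path between two points of `U`, when the segment between them lies in `U`. -/
def segPath {U : Set E} {p q : U} (h : segment ℝ (p : E) q ⊆ U) : Path p q where
  toFun t := ⟨AffineMap.lineMap (p : E) (q : E) (t : ℝ),
    h (lineMap_mem_segment ℝ _ _ t.2)⟩
  continuous_toFun := by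
    refine Continuous.subtype_mk ?_ _
    simp only [AffineMap.lineMap_apply_module]
    fun_prop
  source' := by simp
  target' := by simp

/-- The homotopy class in `U` of the straight path between two points. -/
def segClass {U : Set E} {p q : U} (h : segment ℝ (p : E) q ⊆ U) : Homotopic.Quotient p q :=
  .mk (segPath h)

theorem segClass_through {U S : Set E} {p q : U} (h : segment ℝ (p : E) q ⊆ U) (hS : Convex ℝ S)
    (hp : (p : E) ∈ S) (hq : (q : E) ∈ S) : (segClass h).Through S :=
  ⟨_, rfl, fun t => hS.segment_subset hp hq (lineMap_mem_segment ℝ _ _ t.2)⟩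

theorem segClass_trans {U : Set E} {p q r : U} (hq : (q : E) ∈ segment ℝ (p : E) r)
    (h : segment ℝ (p : E) r ⊆ U)
    (h₁ : segment ℝ (p : E) q ⊆ U) (h₂ : segment ℝ (q : E) r ⊆ U) :
    (segClass h₁).trans (segClass h₂) = segClass h :=
  Homotopic.Quotient.Through.eq_of_convex (convex_segment (p : E) r) h
    ((segClass_through h₁ (convex_segment _ _) (left_mem_segment _ _ _) hq).trans
      (segClass_through h₂ (convex_segment _ _) hq (right_mem_segment _ _ _)))
    (segClass_through h (convex_segment _ _) (left_mem_segment _ _ _) (right_mem_segment _ _ _))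

end Convex

end

/-! ### Boundary loops of punctured rectangles -/

noncomputable section

open Path unitInterval

theorem Complex.convex_reProdIm {s t : Set ℝ} (hs : Convex ℝ s) (ht : Convex ℝ t) :
    Convex ℝ (s ×ℂ t) :=
  (hs.linear_preimage Complex.reLm).inter (ht.linear_preimage Complex.imLm)

theorem Complex.mem_segment_horizontal {a b c x : ℝ} (h : x ∈ Set.Icc a b) :
    (⟨x, c⟩ : ℂ) ∈ segment ℝ (⟨a, c⟩ : ℂ) ⟨b, c⟩ := by
  rw [← segment_eq_Icc (h.1.trans h.2)] at h
  obtain ⟨s, t, hs, ht, hst, rfl⟩ := h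
  refine ⟨s, t, hs, ht, hst, ?_⟩
  apply Complex.ext <;> simp
  rw [← add_mul, hst, one_mul]

theorem Complex.mem_segment_vertical {a c d y : ℝ} (h : y ∈ Set.Icc c d) :
    (⟨a, y⟩ : ℂ) ∈ segment ℝ (⟨a, c⟩ : ℂ) ⟨a, d⟩ := by
  rw [← segment_eq_Icc (h.1.trans h.2)] at h
  obtain ⟨s, t, hs, ht, hst, rfl⟩ := h
  refine ⟨s, t, hs, ht, hst, ?_⟩
  apply Complex.ext <;> simp
  rw [← add_mul, hst, one_mul]

theorem Complex.segment_horizontal_subset {U : Set ℂ} {a b c : ℝ} (hab : a ≤ b)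
    (h : ∀ x ∈ Set.Icc a b, (⟨x, c⟩ : ℂ) ∈ U) : segment ℝ (⟨a, c⟩ : ℂ) ⟨b, c⟩ ⊆ U := by
  rintro _ ⟨s, t, hs, ht, hst, rfl⟩
  have := h (s • a + t • b) ((convex_Icc a b) ⟨le_rfl, hab⟩ ⟨hab, le_rfl⟩ hs ht hst)
  convert this using 1
  apply Complex.ext <;> simp
  rw [← add_mul, hst, one_mul]

theorem Complex.segment_vertical_subset {U : Set ℂ} {a c d : ℝ} (hcd : c ≤ d)
    (h : ∀ y ∈ Set.Icc c d, (⟨a, y⟩ : ℂ) ∈ U) : segment ℝ (⟨a, c⟩ : ℂ) ⟨a, d⟩ ⊆ U := by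
  rintro _ ⟨s, t, hs, ht, hst, rfl⟩
  have := h (s • c + t • d) ((convex_Icc c d) ⟨le_rfl, hcd⟩ ⟨hcd, le_rfl⟩ hs ht hst)
  convert this using 1
  apply Complex.ext <;> simp
  rw [← add_mul, hst, one_mul]

namespace NormalLoops

variable {X : Type*} [TopologicalSpace X] {A B C D M N : X}

/-- With `A B C D` the corners of a rectangle and `M N` a vertical cut, the boundary loop of the
whole is the product of that of the right half, transported along `AM`, and that of the left
half. -/
theorem mem_of_cut_vertical (Q : NormalLoops X) {AM : Homotopic.Quotient A M}
    {MB : Homotopic.Quotient M B} {BC : Homotopic.Quotient B C} {DN : Homotopic.Quotient D N}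
    {NC : Homotopic.Quotient N C} {AD : Homotopic.Quotient A D} {MN : Homotopic.Quotient M N}
    (h₁ : Q.mem (AM.trans (MN.trans (DN.symm.trans AD.symm))))
    (h₂ : Q.mem (MB.trans (BC.trans (NC.symm.trans MN.symm)))) :
    Q.mem ((AM.trans MB).trans (BC.trans ((DN.trans NC).symm.trans AD.symm))) := by
  have := Q.trans_mem (Q.conj_mem AM h₂) h₁
  simp only [Homotopic.Quotient.trans_assoc, Homotopic.Quotient.symm_trans_trans] at this
  simpa only [Homotopic.Quotient.trans_assoc, Homotopic.Quotient.symm_trans_distrib] using this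

/-- With `A B C D` the corners of a rectangle and `N M` a horizontal cut, the boundary loop of the
whole is the product of that of the lower half and that of the upper half, transported along
`AN`. -/
theorem mem_of_cut_horizontal (Q : NormalLoops X) {AB : Homotopic.Quotient A B}
    {BM : Homotopic.Quotient B M} {MC : Homotopic.Quotient M C} {DC : Homotopic.Quotient D C}
    {AN : Homotopic.Quotient A N} {ND : Homotopic.Quotient N D} {NM : Homotopic.Quotient N M}
    (h₁ : Q.mem (AB.trans (BM.trans (NM.symm.trans AN.symm))))
    (h₂ : Q.mem (NM.trans (MC.trans (DC.symm.trans ND.symm)))) :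
    Q.mem (AB.trans ((BM.trans MC).trans (DC.symm.trans (AN.trans ND).symm))) := by
  have := Q.trans_mem h₁ (Q.conj_mem AN h₂)
  simp only [Homotopic.Quotient.trans_assoc, Homotopic.Quotient.symm_trans_trans] at this
  simpa only [Homotopic.Quotient.trans_assoc, Homotopic.Quotient.symm_trans_distrib] using this

end NormalLoops

/-- The boundary of the rectangle `[a, b] × [c, d]` lies in `U`. -/
structure RectBoundaryIn (U : Set ℂ) (a b c d : ℝ) : Prop where
  hab : a ≤ b
  hcd : c ≤ d
  bottom : ∀ x ∈ Set.Icc a b, (⟨x, c⟩ : ℂ) ∈ U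
  top : ∀ x ∈ Set.Icc a b, (⟨x, d⟩ : ℂ) ∈ U
  left : ∀ y ∈ Set.Icc c d, (⟨a, y⟩ : ℂ) ∈ U
  right : ∀ y ∈ Set.Icc c d, (⟨b, y⟩ : ℂ) ∈ U

namespace RectBoundaryIn

variable {U : Set ℂ} {a b c d : ℝ}

/-- The lower left corner. -/
def corner₁ (h : RectBoundaryIn U a b c d) : U := ⟨⟨a, c⟩, h.bottom a ⟨le_rfl, h.hab⟩⟩

/-- The lower right corner. -/
def corner₂ (h : RectBoundaryIn U a b c d) : U := ⟨⟨b, c⟩, h.bottom b ⟨h.hab, le_rfl⟩⟩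

/-- The upper right corner. -/
def corner₃ (h : RectBoundaryIn U a b c d) : U := ⟨⟨b, d⟩, h.top b ⟨h.hab, le_rfl⟩⟩

/-- The upper left corner. -/
def corner₄ (h : RectBoundaryIn U a b c d) : U := ⟨⟨a, d⟩, h.top a ⟨le_rfl, h.hab⟩⟩

/-- The bottom edge, from left to right. -/
def bottomClass (h : RectBoundaryIn U a b c d) : Homotopic.Quotient h.corner₁ h.corner₂ :=
  segClass (Complex.segment_horizontal_subset h.hab h.bottom)

/-- The top edge, from left to right. -/
def topClass (h : RectBoundaryIn U a b c d) : Homotopic.Quotient h.corner₄ h.corner₃ :=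
  segClass (Complex.segment_horizontal_subset h.hab h.top)

/-- The left edge, upwards. -/
def leftClass (h : RectBoundaryIn U a b c d) : Homotopic.Quotient h.corner₁ h.corner₄ :=
  segClass (Complex.segment_vertical_subset h.hcd h.left)

/-- The right edge, upwards. -/
def rightClass (h : RectBoundaryIn U a b c d) : Homotopic.Quotient h.corner₂ h.corner₃ :=
  segClass (Complex.segment_vertical_subset h.hcd h.right)

/-- The boundary loop of the rectangle, counterclockwise from the lower left corner. -/
def loopClass (h : RectBoundaryIn U a b c d) : Homotopic.Quotient h.corner₁ h.corner₁ :=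
  h.bottomClass.trans (h.rightClass.trans (h.topClass.symm.trans h.leftClass.symm))

theorem mem_of_vertical_cut (Q : NormalLoops U) {m : ℝ} (h : RectBoundaryIn U a b c d)
    (h₁ : RectBoundaryIn U a m c d) (h₂ : RectBoundaryIn U m b c d)
    (m₁ : Q.mem h₁.loopClass) (m₂ : Q.mem h₂.loopClass) : Q.mem h.loopClass := by
  have hm : m ∈ Set.Icc a b := ⟨h₁.hab, h₂.hab⟩
  have eb : h₁.bottomClass.trans h₂.bottomClass = h.bottomClass :=
    segClass_trans (p := h.corner₁) (q := h₂.corner₁) (r := h.corner₂)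
      (Complex.mem_segment_horizontal hm) _ _ _
  have et : h₁.topClass.trans h₂.topClass = h.topClass :=
    segClass_trans (p := h.corner₄) (q := h₂.corner₄) (r := h.corner₃)
      (Complex.mem_segment_horizontal hm) _ _ _
  rw [loopClass, ← eb, ← et]
  exact Q.mem_of_cut_vertical (MN := h₁.rightClass) m₁ m₂

theorem mem_of_horizontal_cut (Q : NormalLoops U) {m : ℝ} (h : RectBoundaryIn U a b c d)
    (h₁ : RectBoundaryIn U a b c m) (h₂ : RectBoundaryIn U a b m d)
    (m₁ : Q.mem h₁.loopClass) (m₂ : Q.mem h₂.loopClass) : Q.mem h.loopClass := by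
  have hm : m ∈ Set.Icc c d := ⟨h₁.hcd, h₂.hcd⟩
  have el : h₁.leftClass.trans h₂.leftClass = h.leftClass :=
    segClass_trans (p := h.corner₁) (q := h₂.corner₁) (r := h.corner₄)
      (Complex.mem_segment_vertical hm) _ _ _
  have er : h₁.rightClass.trans h₂.rightClass = h.rightClass :=
    segClass_trans (p := h.corner₂) (q := h₂.corner₂) (r := h.corner₃)
      (Complex.mem_segment_vertical hm) _ _ _
  rw [loopClass, ← el, ← er]
  exact Q.mem_of_cut_horizontal (NM := h₁.topClass) m₁ m₂

/-- The boundary loop of a rectangle contained in `U` is null-homotopic. -/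
theorem loopClass_eq_refl (h : RectBoundaryIn U a b c d)
    (hU : Set.Icc a b ×ℂ Set.Icc c d ⊆ U) : h.loopClass = Homotopic.Quotient.refl _ := by
  have hc : Convex ℝ (Set.Icc a b ×ℂ Set.Icc c d) := 
    Complex.convex_reProdIm (convex_Icc a b) (convex_Icc c d)
  have h₁ : (h.corner₁ : ℂ) ∈ Set.Icc a b ×ℂ Set.Icc c d :=
    ⟨⟨le_rfl, h.hab⟩, ⟨le_rfl, h.hcd⟩⟩
  have h₂ : (h.corner₂ : ℂ) ∈ Set.Icc a b ×ℂ Set.Icc c d :=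
    ⟨⟨h.hab, le_rfl⟩, ⟨le_rfl, h.hcd⟩⟩
  have h₃ : (h.corner₃ : ℂ) ∈ Set.Icc a b ×ℂ Set.Icc c d :=
    ⟨⟨h.hab, le_rfl⟩, ⟨h.hcd, le_rfl⟩⟩
  have h₄ : (h.corner₄ : ℂ) ∈ Set.Icc a b ×ℂ Set.Icc c d :=
    ⟨⟨le_rfl, h.hab⟩, ⟨h.hcd, le_rfl⟩⟩
  refine Homotopic.Quotient.Through.eq_of_convex hc hU (.trans ?_ (.trans ?_ (.trans (.symm ?_) (.symm ?_)))) (.refl h₁)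
  · exact segClass_through _ hc h₁ h₂
  · exact segClass_through _ hc h₂ h₃
  · exact segClass_through _ hc h₄ h₃
  · exact segClass_through _ hc h₁ h₄

end RectBoundaryIn

/-- A loop is the product of the four pieces into which three parameters cut it; `S i` is any set
which contains the values on the `i`-th piece. -/
theorem Path.Homotopic.exists_quarters {E : Type*} [TopologicalSpace E] {U : Set E} {x : U}
    (γ : Path x x) (S : Fin 4 → Set E) {s₁ s₂ s₃ : I} (h₁₂ : s₁ ≤ s₂) (h₂₃ : s₂ ≤ s₃)
    (h₀ : ∀ t ≤ s₁, (γ t : E) ∈ S 0) (h₁ : ∀ t, s₁ ≤ t → t ≤ s₂ → (γ t : E) ∈ S 1)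
    (h₂ : ∀ t, s₂ ≤ t → t ≤ s₃ → (γ t : E) ∈ S 2) (h₃ : ∀ t, s₃ ≤ t → (γ t : E) ∈ S 3) :
    ∃ (A₀ : Homotopic.Quotient x (γ s₁)) (A₁ : Homotopic.Quotient (γ s₁) (γ s₂))
      (A₂ : Homotopic.Quotient (γ s₂) (γ s₃)) (A₃ : Homotopic.Quotient (γ s₃) x),
      A₀.Through (S 0) ∧ A₁.Through (S 1) ∧ A₂.Through (S 2) ∧ A₃.Through (S 3) ∧
        Homotopic.Quotient.mk γ = A₀.trans (A₁.trans (A₂.trans A₃)) := by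
  have key : ∀ {s t : I}, s ≤ t → ∀ r, ∃ r' ∈ Set.Icc s t, γ.subpath s t r = γ r' := by
    intro s t hst r
    have : γ.subpath s t r ∈ Set.range (γ.subpath s t) := ⟨r, rfl⟩
    rw [Path.range_subpath_of_le γ s t hst] at this
    obtain ⟨r', hr', e⟩ := this
    exact ⟨r', hr', e.symm⟩
  refine ⟨.mk ((γ.subpath 0 s₁).cast γ.source.symm rfl), .mk (γ.subpath s₁ s₂),
    .mk (γ.subpath s₂ s₃), .mk ((γ.subpath s₃ 1).cast rfl γ.target.symm),
    ⟨_, rfl, fun t => ?_⟩, ⟨_, rfl, fun t => ?_⟩, ⟨_, rfl, fun t => ?_⟩, ⟨_, rfl, fun t => ?_⟩, ?_⟩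
  · obtain ⟨r, hr, e⟩ := key (unitInterval.nonneg' (t := s₁)) t
    rw [Path.cast_coe, e]; exact h₀ r hr.2
  · obtain ⟨r, hr, e⟩ := key h₁₂ t
    rw [e]; exact h₁ r hr.1 hr.2
  · obtain ⟨r, hr, e⟩ := key h₂₃ t
    rw [e]; exact h₂ r hr.1 hr.2
  · obtain ⟨r, hr, e⟩ := key (unitInterval.le_one' (t := s₃)) t
    rw [Path.cast_coe, e]; exact h₃ r hr.1
  · have h : (γ.subpath 0 1).Homotopic ((γ.subpath 0 s₁).trans ((γ.subpath s₁ s₂).trans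
        ((γ.subpath s₂ s₃).trans (γ.subpath s₃ 1)))) :=
      Path.Homotopic.trans ⟨(Path.Homotopy.subpathTransSubpath γ 0 s₁ 1).symm⟩ <|
      .hcomp (.refl _) <|
      Path.Homotopic.trans ⟨(Path.Homotopy.subpathTransSubpath γ s₁ s₂ 1).symm⟩ <|
      .hcomp (.refl _) ⟨(Path.Homotopy.subpathTransSubpath γ s₂ s₃ 1).symm⟩
    rw [Path.subpath_zero_one] at h
    exact Homotopic.Quotient.eq.2 (h.pathCast γ.source.symm γ.target.symm)

namespace RectBoundaryIn

variable {U : Set ℂ} {a b c d : ℝ}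

open Filter Topology in
/-- If `U` contains the rectangle except for one inner point `z`, then the boundary loop of the
rectangle is conjugate to a small circle around `z`. The four half rectangles below, to the right
of, above and to the left of `z` are convex subsets of `U`; each of them contains one edge, one
quarter of the circle, and the two segments which join their end points. -/
theorem mem_loopClass_of_singleton (Q : NormalLoops U) (h : RectBoundaryIn U a b c d) {z : ℂ}
    (hz : z ∈ Set.Ioo a b ×ℂ Set.Ioo c d) (hU : (Set.Icc a b ×ℂ Set.Icc c d) \ {z} ⊆ U)
    (hQ : ∀ᶠ w in 𝓝[≠] (0 : ℂ), ∀ u : C(Circle, U), (∀ ζ, (u ζ : ℂ) = z + w * ζ) →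
      Q.circleMem u) : Q.mem h.loopClass := by
  obtain ⟨⟨hz₁, hz₂⟩, hz₃, hz₄⟩ := hz
  -- The circle starts at `z + ε (-1 - i)`, in the direction of the lower left corner, so that its
  -- quarters lie in the half planes below, to the right of, above and to the left of `z`.
  obtain ⟨ε, ε0, hε₁, hε₂, hε₃, hε₄, hε⟩ : ∃ ε : ℝ, 0 < ε ∧ 2 * ε < z.re - a ∧ 2 * ε < b - z.re ∧
      2 * ε < z.im - c ∧ 2 * ε < d - z.im ∧
      ∀ u : C(Circle, U), (∀ ζ, (u ζ : ℂ) = z + (ε * (-1 - Complex.I)) * ζ) → Q.circleMem u := by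
    have ht : Tendsto (fun ε : ℝ => (ε : ℂ) * (-1 - Complex.I)) (𝓝[>] 0) (𝓝[≠] 0) := by
      refine tendsto_nhdsWithin_iff.2 ⟨?_, ?_⟩
      · have : Continuous fun ε : ℝ => (ε : ℂ) * (-1 - Complex.I) := by fun_prop
        exact (this.tendsto' 0 0 (by simp)).mono_left nhdsWithin_le_nhds
      · filter_upwards [self_mem_nhdsWithin] with ε hε
        refine mul_ne_zero (by exact_mod_cast (ne_of_gt hε)) fun h => ?_
        simpa using congrArg Complex.re h
    have hs : ∀ r : ℝ, 0 < r → ∀ᶠ ε in 𝓝[>] (0 : ℝ), 2 * ε < r := fun r hr => by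
      filter_upwards [Ioo_mem_nhdsGT (half_pos hr)] with ε hε
      linarith [hε.2]
    have := (eventually_mem_nhdsWithin (a := (0 : ℝ)) (s := Set.Ioi 0)).and <|
      (hs _ (sub_pos.2 hz₁)).and <| (hs _ (sub_pos.2 hz₂)).and <| (hs _ (sub_pos.2 hz₃)).and <|
      (hs _ (sub_pos.2 hz₄)).and (ht.eventually hQ)
    exact this.exists
  have hre : ∀ θ : ℝ, (z + (ε * (-1 - Complex.I)) * (Circle.exp θ : ℂ)).re =
      z.re + ε * (Real.sin θ - Real.cos θ) := fun θ => by
    simp [Complex.exp_ofReal_mul_I_re, Complex.exp_ofReal_mul_I_im]; ring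
  have him : ∀ θ : ℝ, (z + (ε * (-1 - Complex.I)) * (Circle.exp θ : ℂ)).im =
      z.im - ε * (Real.sin θ + Real.cos θ) := fun θ => by
    simp [Complex.exp_ofReal_mul_I_re, Complex.exp_ofReal_mul_I_im]; ring
  let S : Fin 4 → Set ℂ := ![Set.Icc a b ×ℂ Set.Ico c z.im, Set.Ioc z.re b ×ℂ Set.Icc c d,
    Set.Icc a b ×ℂ Set.Ioc z.im d, Set.Ico a z.re ×ℂ Set.Icc c d]
  have hSc : ∀ i, Convex ℝ (S i) := by
    intro i
    fin_cases i
    · exact Complex.convex_reProdIm (convex_Icc _ _) (convex_Ico _ _)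
    · exact Complex.convex_reProdIm (convex_Ioc _ _) (convex_Icc _ _)
    · exact Complex.convex_reProdIm (convex_Icc _ _) (convex_Ioc _ _)
    · exact Complex.convex_reProdIm (convex_Ico _ _) (convex_Icc _ _)
  have hSU : ∀ i, S i ⊆ U := by
    intro i
    fin_cases i
    · exact fun w hw => hU ⟨⟨hw.1, hw.2.1, hw.2.2.le.trans hz₄.le⟩, fun e => (e ▸ hw.2.2).false⟩
    · exact fun w hw => hU ⟨⟨⟨hz₁.le.trans hw.1.1.le, hw.1.2⟩, hw.2⟩, fun e => (e ▸ hw.1.1).false⟩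
    · exact fun w hw => hU ⟨⟨hw.1, hz₃.le.trans hw.2.1.le, hw.2.2⟩, fun e => (e ▸ hw.2.1).false⟩
    · exact fun w hw => hU ⟨⟨⟨hw.1.1, hw.1.2.le.trans hz₂.le⟩, hw.2⟩, fun e => (e ▸ hw.1.2).false⟩
  have hbd : ∀ θ : ℝ, |ε * (Real.sin θ - Real.cos θ)| ≤ 2 * ε ∧
      |ε * (Real.sin θ + Real.cos θ)| ≤ 2 * ε := fun θ => by
    have h₁ := Real.abs_sin_le_one θ
    have h₂ := Real.abs_cos_le_one θ
    rw [abs_le] at h₁ h₂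
    constructor <;> rw [abs_le] <;> constructor <;> nlinarith
  have hcirc : ∀ θ : ℝ, z + (ε * (-1 - Complex.I)) * (Circle.exp θ : ℂ) ∈
      Set.Icc a b ×ℂ Set.Icc c d := fun θ => by
    obtain ⟨h₁, h₂⟩ := hbd θ
    rw [abs_le] at h₁ h₂
    rw [Complex.mem_reProdIm, hre, him]
    exact ⟨⟨by linarith, by linarith⟩, ⟨by linarith, by linarith⟩⟩
  have hw0 : (ε * (-1 - Complex.I) : ℂ) ≠ 0 := by
    refine mul_ne_zero (by exact_mod_cast ε0.ne') fun h => ?_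
    simpa using congrArg Complex.re h
  have huU : ∀ ζ : Circle, z + (ε * (-1 - Complex.I)) * (ζ : ℂ) ∈ U := fun ζ => by
    obtain ⟨θ, rfl⟩ := Circle.exp_surjective ζ
    refine hU ⟨hcirc θ, fun e => ?_⟩
    rw [Set.mem_singleton_iff, add_eq_left] at e
    exact mul_ne_zero hw0 (Circle.coe_ne_zero _) e
  let u : C(Circle, U) := ⟨fun ζ => ⟨z + (ε * (-1 - Complex.I)) * (ζ : ℂ), huU ζ⟩, by fun_prop⟩
  have hu : Q.circleMem u := hε u fun _ => rfl
  let γ := circlePath.map u.continuous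
  have hγ : ∀ t : I, (γ t : ℂ) = z + (ε * (-1 - Complex.I)) *
      (Circle.exp (2 * Real.pi * (t : ℝ)) : ℂ) := fun t => rfl
  have hpi := Real.pi_pos
  have hsc : ∀ θ : ℝ, Real.sin θ ^ 2 + Real.cos θ ^ 2 = 1 := Real.sin_sq_add_cos_sq
  have q₀ : ∀ t : I, (t : ℝ) ≤ 1 / 4 → (γ t : ℂ) ∈ S 0 := by
    intro t ht
    have h0 := t.2.1
    rw [hγ]
    set θ := 2 * Real.pi * (t : ℝ) with hθ
    have hs : 0 ≤ Real.sin θ := Real.sin_nonneg_of_nonneg_of_le_pi (by positivity) (by nlinarith)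
    have hc : 0 ≤ Real.cos θ := Real.cos_nonneg_of_neg_pi_div_two_le_of_le
      (by nlinarith [mul_nonneg hpi.le h0]) (by nlinarith)
    refine ⟨(hcirc θ).1, (hcirc θ).2.1, ?_⟩
    have : 0 < Real.sin θ + Real.cos θ := by nlinarith [hsc θ]
    change _ < _
    rw [him]
    nlinarith
  have q₁ : ∀ t : I, 1 / 4 ≤ (t : ℝ) → (t : ℝ) ≤ 1 / 2 → (γ t : ℂ) ∈ S 1 := by
    intro t h0 ht
    rw [hγ]
    set θ := 2 * Real.pi * (t : ℝ) with hθ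
    have hs : 0 ≤ Real.sin θ := Real.sin_nonneg_of_nonneg_of_le_pi (by nlinarith) (by nlinarith)
    have hc : Real.cos θ ≤ 0 := Real.cos_nonpos_of_pi_div_two_le_of_le
      (by nlinarith) (by nlinarith)
    refine ⟨⟨?_, (hcirc θ).1.2⟩, (hcirc θ).2⟩
    have : 0 < Real.sin θ - Real.cos θ := by nlinarith [hsc θ]
    rw [hre]
    nlinarith
  have hsin : ∀ t : I, 1 / 2 ≤ (t : ℝ) → Real.sin (2 * Real.pi * (t : ℝ)) ≤ 0 := by
    intro t h0
    have h1 := t.2.2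
    rw [← Real.sin_sub_two_pi]
    exact Real.sin_nonpos_of_nonpos_of_neg_pi_le (by nlinarith) (by nlinarith)
  have q₂ : ∀ t : I, 1 / 2 ≤ (t : ℝ) → (t : ℝ) ≤ 3 / 4 → (γ t : ℂ) ∈ S 2 := by
    intro t h0 ht
    have hs := hsin t h0
    rw [hγ]
    set θ := 2 * Real.pi * (t : ℝ) with hθ
    have hc : Real.cos θ ≤ 0 := Real.cos_nonpos_of_pi_div_two_le_of_le
      (by nlinarith) (by nlinarith)
    refine ⟨(hcirc θ).1, ?_, (hcirc θ).2.2⟩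
    have : Real.sin θ + Real.cos θ < 0 := by nlinarith [hsc θ]
    rw [him]
    nlinarith
  have q₃ : ∀ t : I, 3 / 4 ≤ (t : ℝ) → (γ t : ℂ) ∈ S 3 := by
    intro t h0
    have hs := hsin t (by linarith)
    have h1 := t.2.2
    rw [hγ]
    set θ := 2 * Real.pi * (t : ℝ) with hθ
    have hc : 0 ≤ Real.cos θ := by
      rw [← Real.cos_sub_two_pi]
      exact Real.cos_nonneg_of_neg_pi_div_two_le_of_le (by nlinarith) (by nlinarith)
    refine ⟨⟨(hcirc θ).1.1, ?_⟩, (hcirc θ).2⟩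
    have : Real.sin θ - Real.cos θ < 0 := by nlinarith [hsc θ]
    change _ < _
    rw [hre]
    nlinarith
  let s₁ : I := ⟨1 / 4, by norm_num, by norm_num⟩
  let s₂ : I := ⟨1 / 2, by norm_num, by norm_num⟩
  let s₃ : I := ⟨3 / 4, by norm_num, by norm_num⟩
  obtain ⟨A₀, A₁, A₂, A₃, t₀, t₁, t₂, t₃, hA⟩ := Path.Homotopic.exists_quarters γ S
    (s₁ := s₁) (s₂ := s₂) (s₃ := s₃)
    (Subtype.coe_le_coe.1 (by norm_num [s₁, s₂])) (Subtype.coe_le_coe.1 (by norm_num [s₂, s₃]))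
    (fun t ht => q₀ t ht) (fun t ht ht' => q₁ t ht ht') (fun t ht ht' => q₂ t ht ht')
    (fun t ht => q₃ t ht)
  -- Each corner is joined to an end point of a quarter of the circle inside two half rectangles.
  have c₁ : (h.corner₁ : ℂ) ∈ S 0 ∧ (h.corner₁ : ℂ) ∈ S 3 :=
    ⟨⟨⟨le_rfl, h.hab⟩, le_rfl, hz₃⟩, ⟨⟨le_rfl, hz₁⟩, le_rfl, h.hcd⟩⟩
  have c₂ : (h.corner₂ : ℂ) ∈ S 0 ∧ (h.corner₂ : ℂ) ∈ S 1 :=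
    ⟨⟨⟨h.hab, le_rfl⟩, le_rfl, hz₃⟩, ⟨⟨hz₂, le_rfl⟩, le_rfl, h.hcd⟩⟩
  have c₃ : (h.corner₃ : ℂ) ∈ S 1 ∧ (h.corner₃ : ℂ) ∈ S 2 :=
    ⟨⟨⟨hz₂, le_rfl⟩, h.hcd, le_rfl⟩, ⟨⟨h.hab, le_rfl⟩, hz₄, le_rfl⟩⟩
  have c₄ : (h.corner₄ : ℂ) ∈ S 2 ∧ (h.corner₄ : ℂ) ∈ S 3 :=
    ⟨⟨⟨le_rfl, h.hab⟩, hz₄, le_rfl⟩, ⟨⟨le_rfl, hz₁⟩, h.hcd, le_rfl⟩⟩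
  have p₁ : (u 1 : ℂ) ∈ S 0 ∧ (u 1 : ℂ) ∈ S 3 := by
    refine ⟨?_, ?_⟩
    · have := q₀ 0 (by norm_num)
      rwa [γ.source] at this
    · have := q₃ 1 (by norm_num)
      rwa [γ.target] at this
  have p₂ : (γ s₁ : ℂ) ∈ S 0 ∧ (γ s₁ : ℂ) ∈ S 1 :=
    ⟨q₀ s₁ le_rfl, q₁ s₁ le_rfl (by norm_num [s₁])⟩
  have p₃ : (γ s₂ : ℂ) ∈ S 1 ∧ (γ s₂ : ℂ) ∈ S 2 :=
    ⟨q₁ s₂ (by norm_num [s₂]) le_rfl, q₂ s₂ le_rfl (by norm_num [s₂])⟩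
  have p₄ : (γ s₃ : ℂ) ∈ S 2 ∧ (γ s₃ : ℂ) ∈ S 3 :=
    ⟨q₂ s₃ (by norm_num [s₃]) le_rfl, q₃ s₃ le_rfl⟩
  have seg : ∀ {i j : Fin 4} {p q : U}, (p : ℂ) ∈ S i ∧ (p : ℂ) ∈ S j →
      (q : ℂ) ∈ S i ∧ (q : ℂ) ∈ S j →
      ∃ e : Homotopic.Quotient p q, e.Through (S i) ∧ e.Through (S j) := by
    intro i j p q hp hq
    have hsU : segment ℝ (p : ℂ) q ⊆ U := ((hSc i).segment_subset hp.1 hq.1).trans (hSU i)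
    exact ⟨segClass hsU, segClass_through _ (hSc i) hp.1 hq.1, segClass_through _ (hSc j) hp.2 hq.2⟩
  obtain ⟨e₁, e₁l, e₁r⟩ := seg c₁ p₁
  obtain ⟨e₂, e₂l, e₂r⟩ := seg c₂ p₂
  obtain ⟨e₃, e₃l, e₃r⟩ := seg c₃ p₃
  obtain ⟨e₄, e₄l, e₄r⟩ := seg c₄ p₄
  have k₀ : h.bottomClass = e₁.trans (A₀.trans e₂.symm) :=
    Homotopic.Quotient.Through.eq_of_convex (hSc 0) (hSU 0) (segClass_through _ (hSc 0) c₁.1 c₂.1)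
      (e₁l.trans (t₀.trans e₂l.symm))
  have k₁ : h.rightClass = e₂.trans (A₁.trans e₃.symm) :=
    Homotopic.Quotient.Through.eq_of_convex (hSc 1) (hSU 1) (segClass_through _ (hSc 1) c₂.2 c₃.1)
      (e₂r.trans (t₁.trans e₃l.symm))
  have k₂ : h.topClass.symm = e₃.trans (A₂.trans e₄.symm) :=
    Homotopic.Quotient.Through.eq_of_convex (hSc 2) (hSU 2)
      (segClass_through _ (hSc 2) c₄.1 c₃.2).symm (e₃r.trans (t₂.trans e₄l.symm))
  have k₃ : h.leftClass.symm = e₄.trans (A₃.trans e₁.symm) :=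
    Homotopic.Quotient.Through.eq_of_convex (hSc 3) (hSU 3)
      (segClass_through _ (hSc 3) c₁.2 c₄.2).symm (e₄r.trans (t₃.trans e₁r.symm))
  have : h.loopClass = e₁.trans ((Homotopic.Quotient.mk γ).trans e₁.symm) := by
    rw [loopClass, k₀, k₁, k₂, k₃, hA]
    simp only [Homotopic.Quotient.trans_assoc, Homotopic.Quotient.symm_trans_trans]
  rw [this]
  exact Q.conj_mem e₁ hu

open Filter Topology in
/-- If `U` contains a rectangle up to finitely many inner points, and small circles around these
points belong to `Q`, then so does the boundary loop of the rectangle: cut the rectangle by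
horizontal and vertical lines until every piece contains at most one of the points. -/
theorem mem_loopClass_of_finite (Q : NormalLoops U) (h : RectBoundaryIn U a b c d)
    (hfin : ((Set.Icc a b ×ℂ Set.Icc c d) \ U).Finite)
    (hQ : ∀ z ∈ (Set.Icc a b ×ℂ Set.Icc c d) \ U, ∀ᶠ w in 𝓝[≠] (0 : ℂ),
      ∀ u : C(Circle, U), (∀ ζ, (u ζ : ℂ) = z + w * ζ) → Q.circleMem u) :
    Q.mem h.loopClass := by
  induction hn : ((Set.Icc a b ×ℂ Set.Icc c d) \ U).ncard using Nat.strong_induction_on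
    generalizing a b c d with
  | _ n ih =>
  subst hn
  -- the induction hypothesis, for a smaller rectangle which misses one of the points
  have ih' : ∀ {a' b' c' d' : ℝ} (h' : RectBoundaryIn U a' b' c' d'), a ≤ a' → b' ≤ b → c ≤ c' →
      d' ≤ d → ∀ z ∈ (Set.Icc a b ×ℂ Set.Icc c d) \ U, z ∉ Set.Icc a' b' ×ℂ Set.Icc c' d' →
      Q.mem h'.loopClass := by
    intro a' b' c' d' h' ha hb hc hd z hz hz'
    have hsub : (Set.Icc a' b' ×ℂ Set.Icc c' d') \ U ⊆ (Set.Icc a b ×ℂ Set.Icc c d) \ U :=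
      fun w hw => ⟨⟨⟨ha.trans hw.1.1.1, hw.1.1.2.trans hb⟩,
        ⟨hc.trans hw.1.2.1, hw.1.2.2.trans hd⟩⟩, hw.2⟩
    exact ih _ (Set.ncard_lt_ncard ⟨hsub, fun hs => hz' (hs hz).1⟩ hfin) h' (hfin.subset hsub)
      (fun w hw => hQ w (hsub hw)) rfl
  by_cases hre : ∃ z ∈ (Set.Icc a b ×ℂ Set.Icc c d) \ U, ∃ z' ∈ (Set.Icc a b ×ℂ Set.Icc c d) \ U,
      z.re < z'.re
  · obtain ⟨z, hz, z', hz', hlt⟩ := hre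
    obtain ⟨m, hm, hmZ⟩ := ((Set.Ioo_infinite hlt).sdiff (hfin.image Complex.re)).nonempty
    have ham : a ≤ m := hz.1.1.1.trans hm.1.le
    have hmb : m ≤ b := hm.2.le.trans hz'.1.1.2
    have hmU : ∀ y ∈ Set.Icc c d, (⟨m, y⟩ : ℂ) ∈ U := fun y hy => by
      by_contra hU
      exact hmZ ⟨⟨m, y⟩, ⟨⟨⟨ham, hmb⟩, hy⟩, hU⟩, rfl⟩
    have h₁ : RectBoundaryIn U a m c d := ⟨ham, h.hcd, fun x hx => h.bottom x ⟨hx.1, hx.2.trans hmb⟩,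
      fun x hx => h.top x ⟨hx.1, hx.2.trans hmb⟩, h.left, hmU⟩
    have h₂ : RectBoundaryIn U m b c d := ⟨hmb, h.hcd, fun x hx => h.bottom x ⟨ham.trans hx.1, hx.2⟩,
      fun x hx => h.top x ⟨ham.trans hx.1, hx.2⟩, hmU, h.right⟩
    exact h.mem_of_vertical_cut Q h₁ h₂
      (ih' h₁ le_rfl hmb le_rfl le_rfl z' hz' fun hc => hc.1.2.not_gt hm.2)
      (ih' h₂ ham le_rfl le_rfl le_rfl z hz fun hc => hc.1.1.not_gt hm.1)
  by_cases him : ∃ z ∈ (Set.Icc a b ×ℂ Set.Icc c d) \ U, ∃ z' ∈ (Set.Icc a b ×ℂ Set.Icc c d) \ U,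
      z.im < z'.im
  · obtain ⟨z, hz, z', hz', hlt⟩ := him
    obtain ⟨m, hm, hmZ⟩ := ((Set.Ioo_infinite hlt).sdiff (hfin.image Complex.im)).nonempty
    have hcm : c ≤ m := hz.1.2.1.trans hm.1.le
    have hmd : m ≤ d := hm.2.le.trans hz'.1.2.2
    have hmU : ∀ x ∈ Set.Icc a b, (⟨x, m⟩ : ℂ) ∈ U := fun x hx => by
      by_contra hU
      exact hmZ ⟨⟨x, m⟩, ⟨⟨hx, ⟨hcm, hmd⟩⟩, hU⟩, rfl⟩
    have h₁ : RectBoundaryIn U a b c m := ⟨h.hab, hcm, h.bottom, hmU,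
      fun y hy => h.left y ⟨hy.1, hy.2.trans hmd⟩, fun y hy => h.right y ⟨hy.1, hy.2.trans hmd⟩⟩
    have h₂ : RectBoundaryIn U a b m d := ⟨h.hab, hmd, hmU, h.top,
      fun y hy => h.left y ⟨hcm.trans hy.1, hy.2⟩, fun y hy => h.right y ⟨hcm.trans hy.1, hy.2⟩⟩
    exact h.mem_of_horizontal_cut Q h₁ h₂
      (ih' h₁ le_rfl le_rfl le_rfl hmd z' hz' fun hc => hc.2.2.not_gt hm.2)
      (ih' h₂ le_rfl le_rfl hcm le_rfl z hz fun hc => hc.2.1.not_gt hm.1)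
  push Not at hre him
  obtain hZ | ⟨z, hz⟩ := ((Set.Icc a b ×ℂ Set.Icc c d) \ U).eq_empty_or_nonempty
  · rw [h.loopClass_eq_refl (Set.sdiff_eq_empty.1 hZ)]
    exact Q.refl_mem _
  · refine h.mem_loopClass_of_singleton Q (z := z) ⟨⟨?_, ?_⟩, ?_, ?_⟩ ?_ (hQ z hz)
    · exact lt_of_le_of_ne hz.1.1.1 fun e => hz.2 (by simpa [e] using h.left z.im hz.1.2)
    · exact lt_of_le_of_ne hz.1.1.2 fun e => hz.2 (by simpa [← e] using h.right z.im hz.1.2)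
    · exact lt_of_le_of_ne hz.1.2.1 fun e => hz.2 (by simpa [e] using h.bottom z.re hz.1.1)
    · exact lt_of_le_of_ne hz.1.2.2 fun e => hz.2 (by simpa [← e] using h.top z.re hz.1.1)
    · intro w hw
      by_contra hwU
      exact hw.2 (Complex.ext (le_antisymm (hre z hz w ⟨hw.1, hwU⟩) (hre w ⟨hw.1, hwU⟩ z hz))
        (le_antisymm (him z hz w ⟨hw.1, hwU⟩) (him w ⟨hw.1, hwU⟩ z hz)))

end RectBoundaryIn

end

/-! ### Loops near a regular point of the hypersurface -/

noncomputable section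

open Path unitInterval Filter Topology

theorem polyDifferential_apply {n : ℕ} (f : MvPolynomial (Fin n) ℂ) (p v : Fin n → ℂ) :
    polyDifferential f p v =
      ∑ j, MvPolynomial.eval p (MvPolynomial.pderiv j f) * v j := by
  rw [polyDifferential, sum_apply]
  rfl

theorem hasStrictFDerivAt_eval {n : ℕ} (f : MvPolynomial (Fin n) ℂ) (p : Fin n → ℂ) :
    HasStrictFDerivAt (fun z => MvPolynomial.eval z f) (polyDifferential f p) p := by
  induction f using MvPolynomial.induction_on with
  | C a =>
    have : polyDifferential (MvPolynomial.C a) p = 0 := by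
      ext v : 1
      simp [polyDifferential_apply]
    rw [this]
    simp only [MvPolynomial.eval_C]
    exact hasStrictFDerivAt_const a p
  | add f g hf hg =>
    have : polyDifferential (f + g) p = polyDifferential f p + polyDifferential g p := by
      ext v : 1
      simp [polyDifferential_apply, add_mul, Finset.sum_add_distrib]
    rw [this]
    simp only [map_add]
    exact hf.add hg
  | mul_X f i hf =>
    have : polyDifferential (f * MvPolynomial.X i) p =
        MvPolynomial.eval p f • ContinuousLinearMap.proj (R := ℂ) (φ := fun _ => ℂ) i +
          p i • polyDifferential f p := by
      classical
      ext v : 1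
      simp [polyDifferential_apply, MvPolynomial.pderiv_X, add_mul,
        Finset.sum_add_distrib, Finset.mul_sum, Pi.single_apply, mul_assoc]
      rw [Finset.sum_eq_single i] <;> simp +contextual [eq_comm]
    rw [this]
    simp only [map_mul, MvPolynomial.eval_X]
    exact hf.mul (ContinuousLinearMap.proj (R := ℂ) (φ := fun _ => ℂ) i).hasStrictFDerivAt

/-- The map `ℂⁿ - V_f → ℂ - 0` given by `f`. -/
def evalCompl {n : ℕ} (f : MvPolynomial (Fin n) ℂ) : C(HypersurfaceCompl f, ({0}ᶜ : Set ℂ)) where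
  toFun z := ⟨MvPolynomial.eval (z : Fin n → ℂ) f, z.2⟩
  continuous_toFun := Continuous.subtype_mk
    ((MvPolynomial.continuous_eval f).comp continuous_subtype_val) _

/-- Near a regular point `p`, the implicit function theorem identifies `(ℂⁿ, V)` with
`(D × B, 0 × B)` for balls `D` and `B`, where `f` is the first coordinate. A free loop in
`(D - 0) × B` can be contracted to the slice `(D - 0) × 0`, and is therefore determined, up to
homotopy, by the loop `f ∘ u` in `ℂ - 0`. -/
theorem exists_local_homotopy {n : ℕ} {f : MvPolynomial (Fin n) ℂ} {p : Fin n → ℂ}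
    (hp : p ∈ regularPoints f) :
    ∃ W : Set (Fin n → ℂ), IsOpen W ∧ p ∈ W ∧ ∃ Ψ : C(({0}ᶜ : Set ℂ), HypersurfaceCompl f),
      ∀ u : C(Circle, HypersurfaceCompl f), (∀ ζ, (u ζ : Fin n → ℂ) ∈ W) →
        u.Homotopic (Ψ.comp ((evalCompl f).comp u)) := by
  have hsurj : (polyDifferential f p).range = ⊤ := by
    have h : (polyDifferential f p : (Fin n → ℂ) →ₗ[ℂ] ℂ) ≠ 0 := fun h =>
      hp.2 (ContinuousLinearMap.coe_injective h)
    exact LinearMap.range_eq_top.2 (LinearMap.surjective h)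
  let e := (hasStrictFDerivAt_eval f p).implicitToOpenPartialHomeomorph _ _ hsurj
  have hef : ∀ z, (e z).1 = MvPolynomial.eval z f := fun z => rfl
  have hfp : MvPolynomial.eval p f = 0 := hp.1
  have hep : e p = 0 := by
    have : e p = (MvPolynomial.eval p f, 0) :=
      HasStrictFDerivAt.implicitToOpenPartialHomeomorph_self _ _
    rw [this, hfp]; rfl
  have hps : p ∈ e.source := HasStrictFDerivAt.mem_implicitToOpenPartialHomeomorph_source _ _
  obtain ⟨δ, δ0, hδ⟩ := Metric.mem_nhds_iff.1 (e.open_target.mem_nhds (hep ▸ e.map_source hps))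
  let B : Set (ℂ × (polyDifferential f p).ker) := {x | x ∈ Metric.ball 0 δ ∧ x.1 ≠ 0}
  have hB : ∀ x ∈ B, e.symm x ∈ (hypersurface f)ᶜ := fun x hx h => hx.2 <| by
    rw [← e.right_inv (hδ hx.1), hef]; exact h
  let G : C(B, HypersurfaceCompl f) :=
    ⟨fun x => ⟨e.symm x, hB x x.2⟩, Continuous.subtype_mk
      (e.continuousOn_symm.comp_continuous continuous_subtype_val fun x => hδ x.2.1) _⟩
  -- `w ↦ δ w / (1 + |w|)` retracts `ℂ - 0` to `D - 0` along rays.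
  have hρ0 : ∀ w : ℂ, 0 < δ / (1 + ‖w‖) := fun w => by positivity
  have hρ : ∀ w : ℂ, w ≠ 0 → (((δ / (1 + ‖w‖) : ℝ) • w, 0) : ℂ × (polyDifferential f p).ker) ∈ B := by
    intro w hw
    refine ⟨?_, smul_ne_zero (hρ0 w).ne' hw⟩
    rw [mem_ball_zero_iff, Prod.norm_mk, norm_zero, max_lt_iff]
    refine ⟨?_, δ0⟩
    rw [norm_smul, Real.norm_of_nonneg (hρ0 w).le, div_mul_eq_mul_div, div_lt_iff₀ (by positivity)]
    nlinarith [norm_nonneg w]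
  have hρc : Continuous fun w : ℂ =>
      (((δ / (1 + ‖w‖) : ℝ) • w, 0) : ℂ × (polyDifferential f p).ker) := by
    refine Continuous.prodMk (Continuous.smul (continuous_const.div (continuous_const.add continuous_norm) fun w => ?_)
      continuous_id) continuous_const
    have : 0 < 1 + ‖w‖ := by positivity
    exact this.ne'
  refine ⟨e.source ∩ e ⁻¹' Metric.ball 0 δ, e.isOpen_inter_preimage Metric.isOpen_ball,
    ⟨hps, by simp [hep, δ0]⟩,
    G.comp ⟨fun w => ⟨_, hρ w w.2⟩, Continuous.subtype_mk (hρc.comp continuous_subtype_val) _⟩,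
    fun u hu => ⟨?_⟩⟩
  have huc : Continuous fun ζ => e (u ζ) :=
    e.continuousOn.comp_continuous (continuous_subtype_val.comp u.continuous) fun ζ => (hu ζ).1
  have hline : ∀ x : I × Circle, AffineMap.lineMap (e (u x.2))
      (((δ / (1 + ‖(e (u x.2)).1‖) : ℝ) • (e (u x.2)).1, 0) : ℂ × (polyDifferential f p).ker)
      (x.1 : ℝ) ∈ B := by
    intro x
    have hne : (e (u x.2)).1 ≠ 0 := (u x.2).2
    refine ⟨(convex_ball _ _).segment_subset (hu x.2).2 (hρ _ hne).1
      (lineMap_mem_segment ℝ _ _ x.1.2), ?_⟩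
    have h0 := x.1.2.1
    have h1 := x.1.2.2
    rw [AffineMap.lineMap_apply_module]
    simp only [Prod.fst_add, Prod.smul_fst, smul_smul, ← add_smul]
    refine smul_ne_zero (ne_of_gt ?_) hne
    have := hρ0 (e (u x.2)).1
    rcases h0.eq_or_lt with h | h
    · rw [← h]; norm_num
    · exact add_pos_of_nonneg_of_pos (by linarith) (mul_pos h this)
  refine
    { toFun := fun x => G ⟨_, hline x⟩
      continuous_toFun := G.continuous.comp (Continuous.subtype_mk ?_ _)
      map_zero_left := fun ζ => ?_
      map_one_left := fun ζ => ?_ }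
  · simp only [AffineMap.lineMap_apply_module]
    have h1 : Continuous fun x : I × Circle => e (u x.2) := huc.comp continuous_snd
    have h2 := hρc.comp (continuous_fst.comp h1)
    have h3 : Continuous fun x : I × Circle => (x.1 : ℝ) := by fun_prop
    exact ((continuous_const.sub h3).smul h1).add (h3.smul h2)
  · apply Subtype.ext
    change e.symm (AffineMap.lineMap _ _ (0 : ℝ)) = _
    rw [AffineMap.lineMap_apply_zero]
    exact e.left_inv (hu ζ).1
  · apply Subtype.ext
    change e.symm (AffineMap.lineMap _ _ (1 : ℝ)) = _
    rw [AffineMap.lineMap_apply_one]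
    rfl

/-- The inclusion of the unit circle into `ℂ - 0`. -/
def circleIncl : C(Circle, ({0}ᶜ : Set ℂ)) :=
  ⟨fun ζ => ⟨ζ, ζ.coe_ne_zero⟩, Continuous.subtype_mk (by fun_prop) _⟩

/-- A loop in `ℂ - 0` which is closer to `ζ ↦ a ζ` than `|a|` winds once around `0`. -/
theorem homotopic_circleIncl {v : C(Circle, ({0}ᶜ : Set ℂ))} {a : ℂ}
    (hv : ∀ ζ, ‖(v ζ : ℂ) - a * ζ‖ < ‖a‖) : v.Homotopic circleIncl := by
  have ha : a ≠ 0 := fun h => by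
    have := hv 1
    simp only [h, norm_zero] at this
    exact (norm_nonneg _).not_gt this
  let m : C(Circle, ({0}ᶜ : Set ℂ)) :=
    ⟨fun ζ => ⟨a * ζ, mul_ne_zero ha ζ.coe_ne_zero⟩, Continuous.subtype_mk (by fun_prop) _⟩
  have h₁ : v.Homotopic m := by
    have hne : ∀ x : I × Circle,
        AffineMap.lineMap (v x.2 : ℂ) (a * (x.2 : ℂ)) (x.1 : ℝ) ∈ ({0}ᶜ : Set ℂ) := by
      intro x h
      have hx : AffineMap.lineMap (v x.2 : ℂ) (a * (x.2 : ℂ)) (x.1 : ℝ) = 0 := h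
      have : (v x.2 : ℂ) ∈ Metric.ball (a * (x.2 : ℂ)) ‖a‖ := by
        rw [mem_ball_iff_norm]; exact hv x.2
      have := (convex_ball _ _).segment_subset this (Metric.mem_ball_self (norm_pos_iff.2 ha))
        (lineMap_mem_segment ℝ _ _ x.1.2)
      rw [hx, mem_ball_iff_norm, zero_sub, norm_neg, norm_mul, Circle.norm_coe, mul_one] at this
      exact this.false
    refine ⟨{ toFun := fun x => ⟨_, hne x⟩, continuous_toFun := Continuous.subtype_mk ?_ _,
              map_zero_left := fun ζ => ?_, map_one_left := fun ζ => ?_ }⟩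
    · simp only [AffineMap.lineMap_apply_module]; fun_prop
    · exact Subtype.ext (by simp)
    · exact Subtype.ext (by simp [m])
  have h₂ : m.Homotopic circleIncl := by
    refine ⟨{ toFun := fun x => ⟨Complex.exp ((1 - (x.1 : ℝ)) * Complex.log a) * x.2,
                mul_ne_zero (Complex.exp_ne_zero _) x.2.coe_ne_zero⟩,
              continuous_toFun := Continuous.subtype_mk (by fun_prop) _,
              map_zero_left := fun ζ => ?_, map_one_left := fun ζ => ?_ }⟩
    · exact Subtype.ext (by simp [m, Complex.exp_log ha])
    · exact Subtype.ext (by simp [circleIncl])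
  exact h₁.trans h₂

/-- The determinant of `z ↦ α z + β z̄` is `|α|² - |β|²`. -/
theorem det_eq_of_complex (L : ℂ →L[ℝ] ℂ) :
    L.det = ‖(L 1 - Complex.I * L Complex.I) / 2‖ ^ 2 - ‖(L 1 + Complex.I * L Complex.I) / 2‖ ^ 2 := by
  have : L.det = (L 1).re * (L Complex.I).im - (L Complex.I).re * (L 1).im := by
    rw [ContinuousLinearMap.det, ← LinearMap.det_toMatrix Complex.basisOneI, Matrix.det_fin_two]
    simp [LinearMap.toMatrix_apply]
  rw [this, ← Complex.normSq_eq_norm_sq, ← Complex.normSq_eq_norm_sq]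
  simp [Complex.normSq_apply]
  ring

/-- If `g : ℂ → ℂ` vanishes at `0` and its real derivative there preserves orientation, then `g` on
small circles around `0` is dominated by the complex linear part of the derivative. -/
theorem eventually_norm_comp_mul_sub_lt {g : ℂ → ℂ} {L : ℂ →L[ℝ] ℂ} (hg : HasFDerivAt g L 0)
    (hg0 : g 0 = 0) (hL : 0 < L.det) :
    ∀ᶠ w in 𝓝[≠] (0 : ℂ), ∃ a : ℂ, ∀ ζ : Circle, ‖g (w * ζ) - a * ζ‖ < ‖a‖ := by
  set α := (L 1 - Complex.I * L Complex.I) / 2 with hα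
  set β := (L 1 + Complex.I * L Complex.I) / 2 with hβ
  have hLz : ∀ z : ℂ, L z = α * z + β * (starRingEnd ℂ) z := by
    intro z
    have hz : z = z.re • (1 : ℂ) + z.im • Complex.I := by
      apply Complex.ext <;> simp
    have : L z = z.re • L 1 + z.im • L Complex.I := by
      conv_lhs => rw [hz]
      rw [map_add, map_smul, map_smul]
    rw [this]
    apply Complex.ext <;> simp [hα, hβ] <;> ring
  have hαβ : ‖β‖ < ‖α‖ := by
    rw [det_eq_of_complex, sub_pos] at hL
    exact lt_of_pow_lt_pow_left₀ 2 (norm_nonneg _) hL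
  have ho := hasFDerivAt_iff_isLittleO_nhds_zero.1 hg
  have hη : 0 < (‖α‖ - ‖β‖) / 2 := by linarith
  have := ho.def hη
  obtain ⟨r, r0, hr⟩ := Metric.eventually_nhds_iff.1 this
  have hmem : ∀ᶠ w in 𝓝[≠] (0 : ℂ), dist w 0 < r ∧ w ≠ 0 := by
    filter_upwards [nhdsWithin_le_nhds (Metric.ball_mem_nhds (0 : ℂ) r0), self_mem_nhdsWithin]
      with w hw hw' using ⟨hw, hw'⟩
  filter_upwards [hmem] with w hw
  refine ⟨α * w, fun ζ => ?_⟩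
  have hwz : ‖w * (ζ : ℂ)‖ = ‖w‖ := by rw [norm_mul, Circle.norm_coe, mul_one]
  have h1 := hr (y := w * ζ) (by rw [dist_zero_right, hwz]; simpa using hw.1)
  rw [zero_add, hg0, sub_zero, hLz, hwz] at h1
  have hw0 : 0 < ‖w‖ := norm_pos_iff.2 hw.2
  have e : g (w * ζ) - α * w * ζ = (g (w * ζ) - (α * (w * ζ) + β * (starRingEnd ℂ) (w * ζ))) +
      β * (starRingEnd ℂ) (w * ζ) := by ring
  have h2 : ‖β * (starRingEnd ℂ) (w * (ζ : ℂ))‖ = ‖β‖ * ‖w‖ := by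
    rw [norm_mul, RCLike.norm_conj, hwz]
  rw [e, norm_mul α]
  refine (norm_add_le _ _).trans_lt ?_
  rw [h2]
  nlinarith

end

/-! ### Meridians along a component of the regular points -/

noncomputable section

open Path unitInterval Filter Topology

variable {n : ℕ} {f : MvPolynomial (Fin n) ℂ}

/-- The restriction of `φ` to the unit circle, as a free loop in `X`. The path `circleLoop X φ` is
the image of `circlePath` under it. -/
def sphereMap {E : Type*} [TopologicalSpace E] (X : Set E) (φ : ℂ → E)
    (hφ : ContinuousOn φ (Metric.sphere 0 1)) (hX : ∀ z ∈ Metric.sphere (0 : ℂ) 1, φ z ∈ X) :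
    C(Circle, X) :=
  ⟨fun ζ => ⟨φ ζ, hX ζ (mem_sphere_zero_iff_norm.2 ζ.norm_coe)⟩,
    Continuous.subtype_mk (hφ.comp_continuous (by fun_prop) fun ζ =>
      mem_sphere_zero_iff_norm.2 ζ.norm_coe) _⟩

/-- Moving the factor `w` along a path deforms the loop `ζ ↦ φ (w ζ)`. -/
theorem homotopic_of_path {E : Type*} [TopologicalSpace E] {X : Set E} {φ : ℂ → E} {D : Set ℂ}
    (hφ : ContinuousOn φ D) {w₀ w₁ : ℂ} (c : Path w₀ w₁) (hD : ∀ s, ∀ ζ : Circle, c s * ζ ∈ D)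
    (hX : ∀ s, ∀ ζ : Circle, φ (c s * ζ) ∈ X) {u v : C(Circle, X)}
    (hu : ∀ ζ, (u ζ : E) = φ (w₀ * ζ)) (hv : ∀ ζ, (v ζ : E) = φ (w₁ * ζ)) : u.Homotopic v :=
  ⟨{ toFun := fun x => ⟨φ (c x.1 * x.2), hX x.1 x.2⟩
     continuous_toFun := Continuous.subtype_mk
      (hφ.comp_continuous (f := fun x : I × Circle => c x.1 * (x.2 : ℂ)) (by fun_prop)
        fun x => hD x.1 x.2) _
     map_zero_left := fun ζ => Subtype.ext (by simp [hu])
     map_one_left := fun ζ => Subtype.ext (by simp [hv]) }⟩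

theorem exists_pos_of_eventually_punctured {P : ℂ → Prop} (h : ∀ᶠ w in 𝓝[≠] (0 : ℂ), P w) :
    ∃ ε : ℝ, 0 < ε ∧ ε < 1 ∧ P ε := by
  have ht : Tendsto (fun ε : ℝ => (ε : ℂ)) (𝓝[>] 0) (𝓝[≠] 0) := by
    refine tendsto_nhdsWithin_iff.2 ⟨?_, ?_⟩
    · exact (Complex.continuous_ofReal.tendsto' 0 0 (by simp)).mono_left nhdsWithin_le_nhds
    · filter_upwards [self_mem_nhdsWithin] with ε hε
      exact Complex.ofReal_ne_zero.2 (ne_of_gt hε)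
  have h01 : ∀ᶠ ε in 𝓝[>] (0 : ℝ), ε ∈ Set.Ioo 0 1 := Ioo_mem_nhdsGT zero_lt_one
  obtain ⟨ε, hε, hP⟩ := (h01.and (ht.eventually h)).exists
  exact ⟨ε, hε.1, hε.2, hP⟩

/-- The free loop `u` in the complement of `V_f` has linking number one with `V_f`, that is, `f ∘ u`
winds once around `0`. -/
def LinksOnce (u : C(Circle, HypersurfaceCompl f)) : Prop :=
  ((evalCompl f).comp u).Homotopic circleIncl

/-- Near a regular point, all loops of linking number one with `V` are freely homotopic. -/
theorem exists_homotopic_of_linksOnce {p : Fin n → ℂ} (hp : p ∈ regularPoints f) :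
    ∃ W : Set (Fin n → ℂ), IsOpen W ∧ p ∈ W ∧ ∀ u v : C(Circle, HypersurfaceCompl f),
      (∀ ζ, (u ζ : Fin n → ℂ) ∈ W) → LinksOnce u → (∀ ζ, (v ζ : Fin n → ℂ) ∈ W) → LinksOnce v →
        u.Homotopic v := by
  obtain ⟨W, hW, hpW, Ψ, hΨ⟩ := exists_local_homotopy hp
  refine ⟨W, hW, hpW, fun u v hu hu' hv hv' => (hΨ u hu).trans (.trans ?_ (hΨ v hv).symm)⟩
  exact (ContinuousMap.Homotopic.refl Ψ).comp (hu'.trans hv'.symm)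

/-- The small circles around the center of a disk which meets `V` transversely and positively at its
center have linking number one with `V`. -/
theorem eventually_linksOnce {d : ℂ → Fin n → ℂ} {W : Set (Fin n → ℂ)} (hW : IsOpen W)
    (hd : ContinuousAt d 0) (hdW : d 0 ∈ W) (hd0 : d 0 ∈ hypersurface f) {L : ℂ →L[ℝ] ℂ}
    (hL : HasFDerivAt (fun z => MvPolynomial.eval (d z) f) L 0) (hdet : 0 < L.det) :
    ∀ᶠ w in 𝓝[≠] (0 : ℂ), (∀ ζ : Circle, d (w * ζ) ∉ hypersurface f) ∧
      ∀ u : C(Circle, HypersurfaceCompl f), (∀ ζ, (u ζ : Fin n → ℂ) = d (w * ζ)) →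
        (∀ ζ, (u ζ : Fin n → ℂ) ∈ W) ∧ LinksOnce u := by
  obtain ⟨r, r0, hr⟩ := Metric.mem_nhds_iff.1 (hd (hW.mem_nhds hdW))
  filter_upwards [eventually_norm_comp_mul_sub_lt hL hd0 hdet,
    nhdsWithin_le_nhds (Metric.ball_mem_nhds (0 : ℂ) r0)] with w hw hwr
  obtain ⟨a, ha⟩ := hw
  refine ⟨fun ζ hζ => ?_, fun u hu => ⟨fun ζ => ?_, ?_⟩⟩
  · have := ha ζ
    rw [show MvPolynomial.eval (d (w * ζ)) f = 0 from hζ, zero_sub, norm_neg, norm_mul,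
      Circle.norm_coe, mul_one] at this
    exact this.false
  · rw [hu]
    refine hr ?_
    rw [mem_ball_zero_iff, norm_mul, Circle.norm_coe, mul_one]
    simpa using hwr
  · refine homotopic_circleIncl (a := a) fun ζ => ?_
    have := ha ζ
    rw [← hu] at this
    exact this

theorem HasDerivAt.exists_hasFDerivAt_det_pos {g : ℂ → ℂ} {c z : ℂ} (h : HasDerivAt g c z)
    (hc : c ≠ 0) : ∃ L : ℂ →L[ℝ] ℂ, HasFDerivAt g L z ∧ 0 < L.det := by
  refine ⟨_, h.hasFDerivAt.restrictScalars ℝ, ?_⟩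
  rw [det_eq_of_complex]
  have h1 : (1 : ℂ) * c - Complex.I * (Complex.I * c) = 2 * c := by
    linear_combination -c * Complex.I_mul_I
  have h2 : (1 : ℂ) * c + Complex.I * (Complex.I * c) = 0 := by
    linear_combination c * Complex.I_mul_I
  simp only [ContinuousLinearMap.coe_restrictScalars', ContinuousLinearMap.toSpanSingleton_apply,
    smul_eq_mul, h1, h2]
  simp only [mul_div_cancel_left₀ _ (two_ne_zero (α := ℂ)), zero_div, norm_zero]
  have := pow_pos (norm_pos_iff.2 hc) 2
  simp
  exact this

theorem exists_linksOnce {p : Fin n → ℂ} (hp : p ∈ regularPoints f) {W : Set (Fin n → ℂ)}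
    (hW : IsOpen W) (hpW : p ∈ W) :
    ∃ u : C(Circle, HypersurfaceCompl f), (∀ ζ, (u ζ : Fin n → ℂ) ∈ W) ∧ LinksOnce u := by
  obtain ⟨v, hv⟩ : ∃ v, polyDifferential f p v ≠ 0 := by
    by_contra! h
    exact hp.2 (ContinuousLinearMap.ext h)
  let d : ℂ → Fin n → ℂ := fun z => p + z • v
  have hdc : Continuous d := by fun_prop
  have hd0 : d 0 = p := by simp [d]
  obtain ⟨L, hL, hdet⟩ : ∃ L : ℂ →L[ℝ] ℂ,
      HasFDerivAt (fun z => MvPolynomial.eval (d z) f) L 0 ∧ 0 < L.det := by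
    have h1 : HasDerivAt d v 0 := by
      have := ((hasDerivAt_id (0 : ℂ)).smul_const v).const_add p
      rwa [one_smul] at this
    have h2 : HasFDerivAt (fun z => MvPolynomial.eval z f) (polyDifferential f p) (d 0) :=
      hd0 ▸ (hasStrictFDerivAt_eval f p).hasFDerivAt
    exact (h2.comp_hasDerivAt (0 : ℂ) h1).exists_hasFDerivAt_det_pos hv
  obtain ⟨ε, ε0, -, hV, hε⟩ := exists_pos_of_eventually_punctured <|
    eventually_linksOnce hW hdc.continuousAt (hd0.symm ▸ hpW) (hd0.symm ▸ hp.1) hL hdet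
  exact ⟨⟨fun ζ => ⟨d (ε * ζ), hV ζ⟩, Continuous.subtype_mk (by fun_prop) _⟩, hε _ fun _ => rfl⟩

/-- All positive meridians of `V_f` which are sufficiently close to `p` belong to `Q`. -/
def MeridiansMem (Q : NormalLoops (HypersurfaceCompl f)) (p : Fin n → ℂ) : Prop :=
  ∃ W : Set (Fin n → ℂ), IsOpen W ∧ p ∈ W ∧ ∀ u : C(Circle, HypersurfaceCompl f),
    (∀ ζ, (u ζ : Fin n → ℂ) ∈ W) → LinksOnce u → Q.circleMem u

/-- The boundary of a positive normal disk at `p` shrinks, inside the disk, to a small meridian. -/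
theorem meridiansMem_of_disk (Q : NormalLoops (HypersurfaceCompl f)) {p : Fin n → ℂ}
    (hp : p ∈ regularPoints f) (d : PositiveNormalDisk f p)
    (hd : Q.circleMem (sphereMap (hypersurface f)ᶜ d.toFun d.continuousOn_sphere
      d.notMem_of_mem_sphere)) : MeridiansMem Q p := by
  obtain ⟨W, hW, hpW, hhom⟩ := exists_homotopic_of_linksOnce hp
  refine ⟨W, hW, hpW, fun u hu hu' => ?_⟩
  obtain ⟨R, hR, hsm⟩ := d.smooth
  have h0R : Metric.ball (0 : ℂ) R ∈ 𝓝 0 := Metric.ball_mem_nhds _ (by linarith)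
  have hdiff : DifferentiableAt ℝ d.toFun 0 :=
    (hsm.contDiffAt h0R).differentiableAt (by simp)
  have hL : HasFDerivAt (fun z => MvPolynomial.eval (d.toFun z) f)
      (((polyDifferential f p).restrictScalars ℝ).comp (fderiv ℝ d.toFun 0)) 0 := by
    have h2 : HasFDerivAt (fun z => MvPolynomial.eval z f)
        ((polyDifferential f p).restrictScalars ℝ) (d.toFun 0) :=
      d.center.symm ▸ (hasStrictFDerivAt_eval f p).hasFDerivAt.restrictScalars ℝ
    exact h2.comp (0 : ℂ) hdiff.hasFDerivAt
  obtain ⟨ε, ε0, ε1, hV, hε⟩ := exists_pos_of_eventually_punctured <|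
    eventually_linksOnce hW hdiff.continuousAt (d.center.symm ▸ hpW) (d.center.symm ▸ hp.1) hL
      d.positive
  have hball : ∀ s : I, 0 < ‖AffineMap.lineMap (ε : ℂ) (1 : ℂ) (s : ℝ)‖ ∧
      ‖AffineMap.lineMap (ε : ℂ) (1 : ℂ) (s : ℝ)‖ ≤ 1 := by
    intro s
    have h0 := s.2.1
    have h1 := s.2.2
    have e : AffineMap.lineMap (ε : ℂ) (1 : ℂ) (s : ℝ) = ((1 - s) * ε + s : ℝ) := by
      rw [AffineMap.lineMap_apply_module]
      simp
    have hpos : (0 : ℝ) < (1 - s) * ε + s := by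
      rcases h0.eq_or_lt with h | h
      · rw [← h]; linarith
      · exact add_pos_of_nonneg_of_pos (mul_nonneg (by linarith) ε0.le) h
    rw [e, Complex.norm_real, Real.norm_of_nonneg hpos.le]
    exact ⟨hpos, by nlinarith⟩
  have hmem : ∀ s : I, ∀ ζ : Circle, AffineMap.lineMap (ε : ℂ) (1 : ℂ) (s : ℝ) * (ζ : ℂ) ∈
      Metric.closedBall (0 : ℂ) 1 := fun s ζ => by
    rw [mem_closedBall_zero_iff, norm_mul, Circle.norm_coe, mul_one]
    exact (hball s).2
  have hcont : ContinuousOn d.toFun (Metric.closedBall 0 1) :=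
    hsm.continuousOn.mono (Metric.closedBall_subset_ball hR)
  let v : C(Circle, HypersurfaceCompl f) := ⟨fun ζ => ⟨d.toFun (ε * ζ), hV ζ⟩,
    Continuous.subtype_mk (hcont.comp_continuous (by fun_prop) fun ζ => by
      simpa using hmem 0 ζ) _⟩
  obtain ⟨hv, hv'⟩ := hε v fun _ => rfl
  refine Q.circleMem_of_homotopic (hhom u v hu hu' hv hv') (Q.circleMem_of_homotopic ?_ hd)
  refine homotopic_of_path hcont (Path.segment (ε : ℂ) 1) hmem (fun s ζ => ?_) (fun _ => rfl)
    fun ζ => by simp [sphereMap]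
  intro h
  have := (d.mem_iff _ (hmem s ζ)).1 h
  exact mul_ne_zero (norm_pos_iff.1 (hball s).1) ζ.coe_ne_zero this

/-- The small meridians at nearby regular points are freely homotopic, so that either all or none of
them belong to `Q`. -/
theorem isClopen_meridiansMem (Q : NormalLoops (HypersurfaceCompl f)) :
    IsClopen {p : regularPoints f | MeridiansMem Q p} := by
  constructor
  · rw [← isOpen_compl_iff, isOpen_iff_mem_nhds]
    intro p hp
    obtain ⟨W, hW, hpW, hhom⟩ := exists_homotopic_of_linksOnce p.2
    filter_upwards [continuous_subtype_val.continuousAt (hW.mem_nhds hpW)] with q hqW hq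
    obtain ⟨W', hW', hqW', hmem⟩ := hq
    obtain ⟨v, hv, hv'⟩ := exists_linksOnce q.2 (hW.inter hW') ⟨hqW, hqW'⟩
    exact hp ⟨W, hW, hpW, fun u hu hu' => Q.circleMem_of_homotopic
      (hhom u v hu hu' (fun ζ => (hv ζ).1) hv') (hmem v (fun ζ => (hv ζ).2) hv')⟩
  · rw [isOpen_iff_mem_nhds]
    intro p hp
    obtain ⟨W, hW, hpW, hmem⟩ := hp
    filter_upwards [continuous_subtype_val.continuousAt (hW.mem_nhds hpW)] with q hqW
    exact ⟨W, hW, hqW, hmem⟩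

theorem meridiansMem_of_mem_regularPoints (Q : NormalLoops (HypersurfaceCompl f))
    {b : HypersurfaceCompl f} (l : ∀ C : ConnectedComponents (regularPoints f), Meridian f b C)
    (hl : ∀ C, Q.circleMem (sphereMap (hypersurface f)ᶜ (l C).disk.toFun
      (l C).disk.continuousOn_sphere (l C).disk.notMem_of_mem_sphere)) {p : Fin n → ℂ}
    (hp : p ∈ regularPoints f) : MeridiansMem Q p := by
  let C : ConnectedComponents (regularPoints f) := ConnectedComponents.mk ⟨p, hp⟩
  have h0 : (l C).point ∈ {p : regularPoints f | MeridiansMem Q p} :=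
    meridiansMem_of_disk Q (l C).point.2 (l C).disk (hl C)
  have hC := (isClopen_meridiansMem Q).connectedComponent_subset h0
  have : connectedComponent (l C).point = connectedComponent (⟨p, hp⟩ : regularPoints f) :=
    ConnectedComponents.coe_eq_coe.1 (l C).point_mem
  rw [this] at hC
  exact hC mem_connectedComponent

end

/-! ### Generic translates of polynomial disks -/

noncomputable section

open Polynomial

/-- A form of Gauss's lemma: a square factor over the fraction field gives one over `R`, namely the
square of a primitive polynomial. -/
theorem Polynomial.squarefree_map_fractionRing {R : Type*} [CommRing R] [IsDomain R]
    [UniqueFactorizationMonoid R] {F : R[X]} (hF : Squarefree F) :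
    Squarefree (F.map (algebraMap R (FractionRing R))) := by
  classical
  let : StrongNormalizationMonoid R := UniqueFactorizationMonoid.strongNormalizationMonoid
  let : NormalizedGCDMonoid R := UniqueFactorizationMonoid.toNormalizedGCDMonoid R
  intro G hG
  obtain ⟨b, hb, hbG⟩ := IsLocalization.integerNormalization_spec (nonZeroDivisors R) G
  set g := IsLocalization.integerNormalization (nonZeroDivisors R) G with hg
  have hinj : Function.Injective (algebraMap R (FractionRing R)) := IsFractionRing.injective _ _
  have hF0 : F.map (algebraMap R (FractionRing R)) ≠ 0 :=
    (Polynomial.map_ne_zero_iff hinj).2 hF.ne_zero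
  have hG0 : G ≠ 0 := fun h => hF0 (zero_dvd_iff.1 (by simpa [h] using hG))
  have hb0 : algebraMap R (FractionRing R) b ≠ 0 :=
    (map_ne_zero_iff _ hinj).2 (nonZeroDivisors.ne_zero hb)
  have hpG : g.primPart.map (algebraMap R (FractionRing R)) ∣ G := by
    have h1 : g.primPart.map (algebraMap R (FractionRing R)) ∣
        C (algebraMap R (FractionRing R) b) * G := by
      have : C (algebraMap R (FractionRing R) b) * G = b • G := by rw [Algebra.smul_def]; rfl
      rw [this, ← hbG]
      exact Polynomial.map_dvd _ (Dvd.intro_left _ g.eq_C_content_mul_primPart.symm)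
    exact (isUnit_C.2 hb0.isUnit).dvd_mul_left.1 h1
  have hdvd : g.primPart * g.primPart ∣ F := by
    refine IsPrimitive.dvd_of_fraction_map_dvd_fraction_map (K := FractionRing R)
      (g.isPrimitive_primPart.mul g.isPrimitive_primPart) ?_
    rw [Polynomial.map_mul]
    exact (mul_dvd_mul hpG hpG).trans hG
  exact isUnit_or_eq_zero_of_isUnit_integerNormalization_primPart hG0 (hF _ hdvd)

/-- A squarefree polynomial over a factorial domain of characteristic zero is separable over the
fraction field; clearing denominators in a Bézout identity yields a nonzero constant. -/
theorem Polynomial.exists_bezout_derivative {R : Type*} [CommRing R] [IsDomain R] [CharZero R]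
    [UniqueFactorizationMonoid R] {F : R[X]} (hF : Squarefree F) :
    ∃ (A B : R[X]) (r : R), r ≠ 0 ∧ A * F + B * derivative F = C r := by
  have hs : (F.map (algebraMap R (FractionRing R))).Separable :=
    PerfectField.separable_iff_squarefree.2 (squarefree_map_fractionRing hF)
  obtain ⟨a, b, hab⟩ := hs
  obtain ⟨s, hs, hsa⟩ := IsLocalization.integerNormalization_spec (nonZeroDivisors R) a
  obtain ⟨t, ht, htb⟩ := IsLocalization.integerNormalization_spec (nonZeroDivisors R) b
  set A := IsLocalization.integerNormalization (nonZeroDivisors R) a with hA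
  set B := IsLocalization.integerNormalization (nonZeroDivisors R) b with hB
  refine ⟨C t * A, C s * B, s * t, nonZeroDivisors.ne_zero (mul_mem hs ht), ?_⟩
  apply Polynomial.map_injective _ (IsFractionRing.injective R (FractionRing R))
  have e1 : A.map (algebraMap R (FractionRing R)) = C (algebraMap R _ s) * a := by
    rw [hsa, Algebra.smul_def]; rfl
  have e2 : B.map (algebraMap R (FractionRing R)) = C (algebraMap R _ t) * b := by
    rw [htb, Algebra.smul_def]; rfl
  simp only [Polynomial.map_add, Polynomial.map_mul, Polynomial.map_C, e1, e2, map_mul,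
    ← derivative_map] at hab ⊢
  linear_combination (C (algebraMap R (FractionRing R) s) * C (algebraMap R (FractionRing R) t)) * hab

theorem Polynomial.squarefree_C {R : Type*} [CommRing R] [IsDomain R] {a : R} (ha : Squarefree a) :
    Squarefree (C a : R[X]) := by
  intro g hg
  have hd : (g * g).natDegree = 0 := by
    have := natDegree_le_of_dvd hg (C_ne_zero.2 ha.ne_zero)
    simpa using this
  have hg0 : g ≠ 0 := fun h => by
    rw [h, zero_mul, zero_dvd_iff] at hg
    exact C_ne_zero.2 ha.ne_zero hg
  rw [natDegree_mul hg0 hg0] at hd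
  obtain ⟨c, rfl⟩ := natDegree_eq_zero.1 (by omega : g.natDegree = 0)
  rw [← C_mul, C_dvd_iff_dvd_coeff] at hg
  exact (ha c (by simpa using hg 0)).map C

/-- The endomorphism of `ℂ[z₁, …, zₙ][t]` which fixes `t` and sends `zᵢ` to `zᵢ + Pᵢ(t)`. -/
def translatePoly {n : ℕ} (P : Fin n → ℂ[X]) :
    (MvPolynomial (Fin n) ℂ)[X] →+* (MvPolynomial (Fin n) ℂ)[X] :=
  eval₂RingHom (MvPolynomial.eval₂Hom (C.comp MvPolynomial.C)
    fun i => C (MvPolynomial.X i) + (P i).map MvPolynomial.C) X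

theorem translatePoly_comp_neg {n : ℕ} (P : Fin n → ℂ[X]) :
    (translatePoly P).comp (translatePoly (-P)) = RingHom.id _ := by
  have hc : ∀ Q : ℂ[X], translatePoly P (Q.map MvPolynomial.C) = Q.map MvPolynomial.C := by
    intro Q
    induction Q using Polynomial.induction_on' with
    | add p q hp hq => simp [hp, hq]
    | monomial k a => simp [translatePoly, C_mul_X_pow_eq_monomial]
  apply Polynomial.ringHom_ext
  · intro p
    induction p using MvPolynomial.induction_on with
    | C a => simp [translatePoly]
    | add p q hp hq => simp only [map_add, hp, hq]
    | mul_X p i hp =>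
      simp only [map_mul, hp]
      congr 1
      have : translatePoly (-P) (C (MvPolynomial.X i)) =
        C (MvPolynomial.X i) - (P i).map MvPolynomial.C := by
        simp [translatePoly, sub_eq_add_neg]
      rw [RingHom.comp_apply, this, map_sub, hc]
      simp [translatePoly]
  · simp [translatePoly]

theorem map_eval_translatePoly_C {n : ℕ} (P : Fin n → ℂ[X]) (d : Fin n → ℂ)
    (f : MvPolynomial (Fin n) ℂ) : (translatePoly P (C f)).map (MvPolynomial.eval d) =
      MvPolynomial.aeval (fun i => P i + C (d i)) f := by
  induction f using MvPolynomial.induction_on with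
  | C a => simp [translatePoly]
  | add p q hp hq => simp only [map_add, Polynomial.map_add, hp, hq]
  | mul_X p i hp =>
    simp only [map_mul, Polynomial.map_mul, hp]
    have : (MvPolynomial.eval d).comp MvPolynomial.C = RingHom.id ℂ := by ext; simp
    congr 1
    simp [translatePoly, Polynomial.map_map, this, add_comm]

/-- For generic `d ∈ ℂⁿ`, all zeros of the polynomial `f (P(t) + d)` in `t` are simple. As a
polynomial in `t` and `d`, this is the image of `f` under an automorphism, hence squarefree. -/
theorem exists_generic_translate {n : ℕ} {f : MvPolynomial (Fin n) ℂ} (hf : Squarefree f)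
    (P : Fin n → ℂ[X]) :
    ∃ r : MvPolynomial (Fin n) ℂ, r ≠ 0 ∧ ∀ d : Fin n → ℂ, MvPolynomial.eval d r ≠ 0 → ∀ t : ℂ,
      (MvPolynomial.aeval (fun i => P i + C (d i)) f : ℂ[X]).eval t = 0 →
      (derivative (MvPolynomial.aeval (fun i => P i + C (d i)) f : ℂ[X])).eval t ≠ 0 := by
  let τ : (MvPolynomial (Fin n) ℂ)[X] ≃+* (MvPolynomial (Fin n) ℂ)[X] :=
    RingEquiv.ofRingHom (translatePoly P) (translatePoly (-P)) (translatePoly_comp_neg P)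
      (by simpa using translatePoly_comp_neg (-P))
  have hsq : Squarefree (translatePoly P (C f)) := by
    intro g hg
    have h1 : τ.symm g * τ.symm g ∣ C f := by
      have := map_dvd τ.symm hg
      rw [map_mul] at this
      exact this.trans (dvd_of_eq (τ.symm_apply_apply (C f)))
    have := (squarefree_C hf _ h1).map τ
    rwa [τ.apply_symm_apply] at this
  obtain ⟨A, B, r, hr, hAB⟩ := exists_bezout_derivative hsq
  refine ⟨r, hr, fun d hd t h0 h1 => hd ?_⟩
  have := congrArg (fun p => (p.map (MvPolynomial.eval d)).eval t) hAB
  simp only [Polynomial.map_add, Polynomial.map_mul, ← derivative_map, map_eval_translatePoly_C, eval_add, eval_mul, h0,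
    h1, map_C, eval_C] at this
  simpa using this.symm

end

/-! ### The complement of the hypersurface and its quasipositive loops -/

noncomputable section

open Path unitInterval Polynomial

variable {n : ℕ} {f : MvPolynomial (Fin n) ℂ}

theorem map_aeval_eq_eval {A : Type*} [CommRing A] [Algebra ℂ A] (g : A →+* ℂ)
    (hg : ∀ a, g (algebraMap ℂ A a) = a) (P : Fin n → A) (f : MvPolynomial (Fin n) ℂ) :
    g (MvPolynomial.aeval P f) = MvPolynomial.eval (fun i => g (P i)) f := by
  induction f using MvPolynomial.induction_on with
  | C a => simp [hg]
  | add p q hp hq => simp [hp, hq]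
  | mul_X p i hp => simp [hp]

theorem eval_aeval_polynomial (P : Fin n → ℂ[X]) (f : MvPolynomial (Fin n) ℂ) (t : ℂ) :
    (MvPolynomial.aeval P f : ℂ[X]).eval t = MvPolynomial.eval (fun i => (P i).eval t) f :=
  map_aeval_eq_eval (evalRingHom t) (by simp) P f

/-- The complex line through two points of the complement meets `V` in finitely many points. -/
theorem joined_hypersurfaceCompl (x y : HypersurfaceCompl f) : Nonempty (Path x y) := by
  let L : ℂ[X] := MvPolynomial.aeval
    (fun i => C ((x : Fin n → ℂ) i) + X * C ((y : Fin n → ℂ) i - (x : Fin n → ℂ) i)) f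
  have hL : ∀ t, L.eval t =
      MvPolynomial.eval ((x : Fin n → ℂ) + t • ((y : Fin n → ℂ) - (x : Fin n → ℂ))) f := fun t => by
    rw [eval_aeval_polynomial]
    congr 2
    ext i
    simp
  have h0 : L.eval 0 ≠ 0 := by rw [hL, zero_smul, add_zero]; exact x.2
  have h1 : L.eval 1 ≠ 0 := by rw [hL, one_smul, add_sub_cancel]; exact y.2
  have hfin : {t : ℂ | L.IsRoot t}.Finite :=
    Polynomial.finite_setOfPred_isRoot fun h => h0 (by simp [h])
  have hpc : IsPathConnected {t : ℂ | L.IsRoot t}ᶜ :=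
    hfin.countable.isPathConnected_compl_of_one_lt_rank (by simp [Complex.rank_real_complex])
  obtain ⟨γ, hγ⟩ := hpc.joinedIn 0 h0 1 h1
  refine ⟨⟨⟨fun t => ⟨(x : Fin n → ℂ) + γ t • ((y : Fin n → ℂ) - (x : Fin n → ℂ)), fun h => ?_⟩,
    Continuous.subtype_mk (by fun_prop) _⟩, ?_, ?_⟩⟩
  · exact hγ t ((hL _).trans h)
  · exact Subtype.ext (by simp)
  · exact Subtype.ext (by simp)

/-- The loops in `ℂⁿ - V_f` all of whose transports to the base point `b` are quasipositive. -/
def quasipositiveLoops {b : HypersurfaceCompl f}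
    (l : ∀ C : ConnectedComponents (regularPoints f), Meridian f b C) :
    NormalLoops (HypersurfaceCompl f) where
  mem {x} a := ∀ α : Homotopic.Quotient b x,
    IsQuasipositive l (FundamentalGroup.fromPath (α.trans (a.trans α.symm)))
  refl_mem x α := ⟨[], by simp; rfl⟩
  trans_mem {x a c} ha hc α := by
    obtain ⟨L, hL⟩ := ha α
    obtain ⟨M, hM⟩ := hc α
    refine ⟨M ++ L, ?_⟩
    rw [List.map_append, List.prod_append, ← hL, ← hM, FundamentalGroup.mul_def]
    simp only [Homotopic.Quotient.trans_assoc, Homotopic.Quotient.symm_trans_trans]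
  conj_mem {x y} p a ha α := by
    have := ha (α.trans p)
    simpa only [Homotopic.Quotient.trans_assoc, Homotopic.Quotient.symm_trans_distrib] using this

/-- With `∂` the boundary of the disk and `a` the arc, `α ∂ α⁻¹ = (α a⁻¹) (a ∂ a⁻¹) (α a⁻¹)⁻¹`. -/
theorem circleMem_quasipositiveLoops_disk {b : HypersurfaceCompl f}
    (l : ∀ C : ConnectedComponents (regularPoints f), Meridian f b C)
    (C : ConnectedComponents (regularPoints f)) :
    (quasipositiveLoops l).circleMem (sphereMap (hypersurface f)ᶜ (l C).disk.toFun
      (l C).disk.continuousOn_sphere (l C).disk.notMem_of_mem_sphere) := by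
  intro (α : Homotopic.Quotient b (l C).disk.basePoint)
  let w : FundamentalGroup (HypersurfaceCompl f) b :=
    FundamentalGroup.fromPath ((Homotopic.Quotient.mk (l C).arc).trans α.symm)
  refine ⟨[(w, C)], ?_⟩
  have hl : loopClass (l C).loop = FundamentalGroup.fromPath
    ((Homotopic.Quotient.mk (l C).arc).trans ((Homotopic.Quotient.mk (l C).disk.boundary).trans
      (Homotopic.Quotient.mk (l C).arc).symm)) := rfl
  simp only [List.map_cons, List.map_nil, List.prod_cons, List.prod_nil, mul_one, hl]
  rw [FundamentalGroup.mul_def, FundamentalGroup.mul_def, FundamentalGroup.inv_def]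
  simp only [w, Homotopic.Quotient.trans_assoc, Homotopic.Quotient.symm_trans_distrib,
    Homotopic.Quotient.symm_symm, Homotopic.Quotient.symm_trans_trans]
  rfl

end

/-! ### Boundaries of analytic disks -/

noncomputable section

open Path unitInterval Filter Topology Polynomial

variable {n : ℕ} {f : MvPolynomial (Fin n) ℂ}

/-- The boundary loop `β ρ τ⁻¹ κ⁻¹` of an annulus cut open along `β = τ`, with outer circle `ρ = u`
and inner circle `κ = v`: if it and the inner circle belong to `Q`, then so does the outer circle.
The hypotheses are equalities of values, since the end points of the paths agree only
propositionally. -/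
theorem NormalLoops.circleMem_of_annulus {X : Type*} [TopologicalSpace X] (Q : NormalLoops X)
    {x y x' y' : X} (β : Path x y) (ρ : Path y y') (τ : Path x' y') (κ : Path x x')
    {u v : C(Circle, X)} (hτ : ∀ t, τ t = β t) (hρ : ∀ t, ρ t = u (circlePath t))
    (hκ : ∀ t, κ t = v (circlePath t))
    (hmem : Q.mem ((Homotopic.Quotient.mk β).trans ((Homotopic.Quotient.mk ρ).trans
      ((Homotopic.Quotient.mk τ).symm.trans (Homotopic.Quotient.mk κ).symm))))
    (hv : Q.circleMem v) : Q.circleMem u := by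
  obtain rfl : x' = x := by simpa using hτ 0
  obtain rfl : y' = y := by simpa using hτ 1
  obtain rfl : y' = u 1 := by simpa using hρ 0
  obtain rfl : x' = v 1 := by simpa using hκ 0
  obtain rfl : τ = β := Path.ext (funext hτ)
  obtain rfl : ρ = circlePath.map u.continuous := Path.ext (funext hρ)
  obtain rfl : κ = circlePath.map v.continuous := Path.ext (funext hκ)
  have := Q.trans_mem hmem hv
  simp only [Homotopic.Quotient.trans_assoc, Homotopic.Quotient.symm_trans,
    Homotopic.Quotient.trans_refl] at this
  exact Q.mem_of_conj _ this

/-- A function with simple zeros has finitely many zeros in a compact set. -/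
theorem finite_zeros_of_simple {G G' : ℂ → ℂ} (hG : ∀ w, HasDerivAt G (G' w) w)
    (hsimple : ∀ w, G w = 0 → G' w ≠ 0) {K : Set ℂ} (hK : IsCompact K) :
    (K ∩ {w | G w = 0}).Finite := by
  by_contra hinf
  obtain ⟨x, -, hx⟩ := Set.Infinite.exists_accPt_of_subset_isCompact hinf hK Set.inter_subset_left
  rw [accPt_iff_frequently_nhdsNE] at hx
  have hne : ∀ᶠ w in 𝓝[≠] x, G w ≠ 0 := by
    by_cases h : G x = 0
    · exact (hG x).eventually_ne (hsimple x h)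
    · exact nhdsWithin_le_nhds ((hG x).continuousAt.eventually_ne h)
  obtain ⟨w, hw, hw'⟩ := (hx.and_eventually hne).exists
  exact hw' hw.2

/-- At a simple zero `z` of `f ∘ h`, the map `h` is transverse to `V` at a regular point, so that it
maps small circles around `z` to small positive meridians. -/
theorem eventually_circleMem_comap (Q : NormalLoops (HypersurfaceCompl f))
    (hQ : ∀ p ∈ regularPoints f, MeridiansMem Q p) {h : ℂ → Fin n → ℂ} (hc : Continuous h) {z c : ℂ}
    (hz : h z ∈ hypersurface f) (hd : DifferentiableAt ℂ h z)
    (hG : HasDerivAt (fun w => MvPolynomial.eval (h w) f) c z) (hc0 : c ≠ 0)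
    {U : Set ℂ} (k : C(U, HypersurfaceCompl f)) (hk : ∀ w, (k w : Fin n → ℂ) = h w) :
    ∀ᶠ w in 𝓝[≠] (0 : ℂ), ∀ u : C(Circle, U), (∀ ζ, (u ζ : ℂ) = z + w * ζ) →
      (Q.comap k).circleMem u := by
  have hreg : h z ∈ regularPoints f := by
    refine ⟨hz, fun h0 => hc0 ?_⟩
    have := (hasStrictFDerivAt_eval f (h z)).hasFDerivAt.comp_hasDerivAt z hd.hasDerivAt
    rw [h0] at this
    exact hG.unique this
  obtain ⟨W, hW, hpW, hmem⟩ := hQ _ hreg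
  have hG' : HasDerivAt (fun w => MvPolynomial.eval (h (z + w)) f) c 0 := by
    have : HasDerivAt (fun w => MvPolynomial.eval (h w) f) c (z + 0) := by rwa [add_zero]
    exact this.comp_const_add z 0
  obtain ⟨L, hL, hdet⟩ := hG'.exists_hasFDerivAt_det_pos hc0
  filter_upwards [eventually_linksOnce (d := fun w => h (z + w)) hW (by fun_prop)
    (by simpa using hpW) (by simpa using hz) hL hdet] with w hw u hu
  obtain ⟨h1, h2⟩ := hw.2 (k.comp u) fun ζ => by simp [hk, hu]
  exact hmem _ h1 h2

/-- The case of an entire disk `ψ` which is transverse to `V` and whose center is not on `V`. The map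
`w ↦ ψ (exp w)` turns the annulus `r ≤ |t| ≤ 1`, cut along a ray which avoids the zeros of `f ∘ ψ`,
into a rectangle. -/
theorem circleMem_of_simple_zeros (Q : NormalLoops (HypersurfaceCompl f))
    (hQ : ∀ p ∈ regularPoints f, MeridiansMem Q p) {ψ : ℂ → Fin n → ℂ} (hψ : Differentiable ℂ ψ)
    (h0 : ψ 0 ∉ hypersurface f) (h1 : ∀ z ∈ Metric.sphere (0 : ℂ) 1, ψ z ∈ (hypersurface f)ᶜ)
    (hsimple : ∀ t, ψ t ∈ hypersurface f → deriv (fun t => MvPolynomial.eval (ψ t) f) t ≠ 0) :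
    Q.circleMem (sphereMap (hypersurface f)ᶜ ψ hψ.continuous.continuousOn h1) := by
  have hψc := hψ.continuous
  let g : ℂ → ℂ := fun t => MvPolynomial.eval (ψ t) f
  have hg : Differentiable ℂ g := fun t =>
    ((hasStrictFDerivAt_eval f (ψ t)).hasFDerivAt.comp_hasDerivAt t
      (hψ t).hasDerivAt).differentiableAt
  let h : ℂ → Fin n → ℂ := fun w => ψ (Complex.exp w)
  have hhc : Continuous h := by fun_prop
  have hG : ∀ w, HasDerivAt (fun w => MvPolynomial.eval (h w) f)
      (deriv g (Complex.exp w) * Complex.exp w) w := fun w =>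
    (hg _).hasDerivAt.comp w (Complex.hasDerivAt_exp w)
  have hGs : ∀ w, MvPolynomial.eval (h w) f = 0 → deriv g (Complex.exp w) * Complex.exp w ≠ 0 :=
    fun w hw => mul_ne_zero (hsimple _ hw) (Complex.exp_ne_zero w)
  -- the inner circle of the annulus bounds a disk which does not meet `V`
  obtain ⟨r, r0, r1, hr⟩ : ∃ r : ℝ, 0 < r ∧ r < 1 ∧ ∀ t : ℂ, ‖t‖ ≤ r → ψ t ∈ (hypersurface f)ᶜ := by
    obtain ⟨s, s0, hs⟩ := Metric.mem_nhds_iff.1 (hg.continuous.continuousAt.eventually_ne h0)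
    refine ⟨min (s / 2) (1 / 2), by positivity, (min_le_right _ _).trans_lt (by norm_num),
      fun t ht => hs ?_⟩
    rw [mem_ball_zero_iff]
    linarith [ht.trans (min_le_left _ _)]
  have hlog : Real.log r ≤ 0 := (Real.log_neg r0 r1).le
  have hnorm : ∀ x y : ℝ, ‖Complex.exp ⟨x, y⟩‖ = Real.exp x := fun x y => by
    rw [Complex.norm_exp]
  let U : Set ℂ := {w | h w ∈ (hypersurface f)ᶜ}
  have hcpt : ∀ a b c d : ℝ, IsCompact (Set.Icc a b ×ℂ Set.Icc c d) := fun a b c d =>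
    isCompact_Icc.reProdIm isCompact_Icc
  have hfin : ∀ a b c d : ℝ, ((Set.Icc a b ×ℂ Set.Icc c d) \ U).Finite := fun a b c d => by
    convert finite_zeros_of_simple hG hGs (hcpt a b c d) using 1
    ext w
    simp [U, hypersurface]
  -- the argument `c` of the ray
  obtain ⟨c, hc01, hc⟩ := ((Set.Ioo_infinite (zero_lt_one (α := ℝ))).sdiff
    ((hfin (Real.log r) 0 0 1).image Complex.im)).nonempty
  have hper : ∀ x : ℝ, h ⟨x, c + 2 * Real.pi⟩ = h ⟨x, c⟩ := fun x => by
    have : (⟨x, c + 2 * Real.pi⟩ : ℂ) = ⟨x, c⟩ + 2 * Real.pi * Complex.I := by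
      apply Complex.ext <;> simp
    simp only [h, this, Complex.exp_periodic _]
  have hbot : ∀ x ∈ Set.Icc (Real.log r) 0, (⟨x, c⟩ : ℂ) ∈ U := fun x hx => by
    by_contra hU
    exact hc ⟨⟨x, c⟩, ⟨⟨hx, hc01.1.le, hc01.2.le⟩, hU⟩, rfl⟩
  have R : RectBoundaryIn U (Real.log r) 0 c (c + 2 * Real.pi) :=
    { hab := hlog
      hcd := by linarith [Real.pi_pos]
      bottom := hbot
      top := fun x hx => by
        change h _ ∈ (hypersurface f)ᶜ
        rw [hper]
        exact hbot x hx
      left := fun y _ => hr _ (by rw [hnorm, Real.exp_log r0])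
      right := fun y _ => h1 _ (by rw [mem_sphere_zero_iff_norm, hnorm, Real.exp_zero]) }
  let k : C(U, HypersurfaceCompl f) :=
    ⟨fun w => ⟨h w, w.2⟩, Continuous.subtype_mk (hhc.comp continuous_subtype_val) _⟩
  have hmem : (Q.comap k).mem R.loopClass :=
    R.mem_loopClass_of_finite _ (hfin _ _ _ _) fun z hz =>
      eventually_circleMem_comap Q hQ hhc (not_not.1 hz.2)
        ((hψ _).comp z Complex.differentiableAt_exp) (hG z) (hGs z (not_not.1 hz.2)) k fun _ => rfl
  have hexp : ∀ x t : ℝ, Complex.exp ⟨x, c + 2 * Real.pi * t⟩ =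
      Real.exp x * Complex.exp (c * Complex.I) * (Circle.exp (2 * Real.pi * t) : ℂ) := fun x t => by
    rw [Circle.coe_exp, Complex.ofReal_exp, ← Complex.exp_add, ← Complex.exp_add]
    congr 1
    apply Complex.ext <;> simp
  have hvert : ∀ (a : ℝ) (t : I), AffineMap.lineMap (⟨a, c⟩ : ℂ) ⟨a, c + 2 * Real.pi⟩ (t : ℝ) =
      ⟨a, c + 2 * Real.pi * t⟩ := fun a t => by
    rw [AffineMap.lineMap_apply_module]
    apply Complex.ext <;> simp <;> ring
  have hhor : ∀ (y : ℝ) (t : I), AffineMap.lineMap (⟨Real.log r, y⟩ : ℂ) ⟨0, y⟩ (t : ℝ) =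
      ⟨(1 - t) * Real.log r, y⟩ := fun y t => by
    rw [AffineMap.lineMap_apply_module]
    apply Complex.ext <;> simp
    ring
  have hnormexp : ‖Complex.exp (c * Complex.I)‖ = 1 := Complex.norm_exp_ofReal_mul_I c
  let u : C(Circle, HypersurfaceCompl f) := ⟨fun ζ => ⟨ψ (Complex.exp (c * Complex.I) * ζ),
    h1 _ (by rw [mem_sphere_zero_iff_norm, norm_mul, hnormexp, Circle.norm_coe, one_mul])⟩,
    Continuous.subtype_mk (by fun_prop) _⟩
  let v : C(Circle, HypersurfaceCompl f) := ⟨fun ζ => ⟨ψ (r * Complex.exp (c * Complex.I) * ζ),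
    hr _ (by rw [norm_mul, norm_mul, hnormexp, Circle.norm_coe, mul_one, mul_one,
      Complex.norm_of_nonneg r0.le])⟩, Continuous.subtype_mk (by fun_prop) _⟩
  have hv : Q.circleMem v := by
    refine Q.circleMem_of_homotopic ?_ (Q.circleMem_const ⟨ψ 0, h0⟩)
    refine homotopic_of_path (D := Set.univ) hψc.continuousOn
      (Path.segment (r * Complex.exp (c * Complex.I)) 0) (fun _ _ => Set.mem_univ _)
      (fun s ζ => hr _ ?_) (fun _ => rfl) fun ζ => by simp
    rw [norm_mul, Circle.norm_coe, mul_one, Path.segment_apply, AffineMap.lineMap_apply_module,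
      smul_zero, add_zero, norm_smul, norm_mul, hnormexp, mul_one, Complex.norm_of_nonneg r0.le,
      Real.norm_of_nonneg (by linarith [s.2.2])]
    nlinarith [s.2.1]
  have hu : Q.circleMem u := by
    refine Q.circleMem_of_annulus
      ((segPath (p := R.corner₁) (q := R.corner₂)
        (Complex.segment_horizontal_subset R.hab R.bottom)).map k.continuous)
      ((segPath (p := R.corner₂) (q := R.corner₃)
        (Complex.segment_vertical_subset R.hcd R.right)).map k.continuous)
      ((segPath (p := R.corner₄) (q := R.corner₃)
        (Complex.segment_horizontal_subset R.hab R.top)).map k.continuous)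
      ((segPath (p := R.corner₁) (q := R.corner₄)
        (Complex.segment_vertical_subset R.hcd R.left)).map k.continuous)
      (fun t => ?_) (fun t => ?_) (fun t => ?_) ?_ hv
    · apply Subtype.ext
      change h (AffineMap.lineMap _ _ (t : ℝ)) = h (AffineMap.lineMap _ _ (t : ℝ))
      refine (congrArg h (hhor _ t)).trans ((hper _).trans (congrArg h (hhor _ t)).symm)
    · apply Subtype.ext
      refine (congrArg h (hvert _ t)).trans ?_
      change ψ _ = ψ _
      rw [hexp, Real.exp_zero, Complex.ofReal_one, one_mul]
      rfl
    · apply Subtype.ext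
      refine (congrArg h (hvert _ t)).trans ?_
      change ψ _ = ψ _
      rw [hexp, Real.exp_log r0]
      rfl
    · have : Q.mem (R.loopClass.map k) := hmem
      rw [RectBoundaryIn.loopClass, Homotopic.Quotient.map_trans, Homotopic.Quotient.map_trans,
        Homotopic.Quotient.map_trans, Homotopic.Quotient.map_symm,
        Homotopic.Quotient.map_symm] at this
      exact this
  -- `u` is `ψ` on the circle with starting point `exp (c i)`; rotate it back.
  refine Q.circleMem_of_homotopic ?_ hu
  let p : Path (1 : ℂ) (Complex.exp (c * Complex.I)) :=
    { toFun := fun s => Complex.exp ((s * c : ℝ) * Complex.I)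
      continuous_toFun := by fun_prop
      source' := by simp
      target' := by simp }
  refine homotopic_of_path (D := Set.univ) hψc.continuousOn p (fun _ _ => Set.mem_univ _)
    (fun s ζ => h1 _ ?_) (fun ζ => by simp [sphereMap]) fun _ => rfl
  rw [mem_sphere_zero_iff_norm, norm_mul, Circle.norm_coe, mul_one]
  exact Complex.norm_exp_ofReal_mul_I _

/-- Taylor polynomials approximate an analytic disk uniformly on the unit circle. -/
theorem exists_polynomial_approx {φ : ℂ → Fin n → ℂ} (hφ : IsAnalyticDisk φ) {η : ℝ} (hη : 0 < η) :
    ∃ P : Fin n → ℂ[X], ∀ z ∈ Metric.sphere (0 : ℂ) 1, dist (φ z) (fun i => (P i).eval z) < η := by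
  obtain ⟨R, hR, hφ⟩ := hφ
  obtain ⟨R', hR'1, hR'⟩ := exists_between hR
  obtain ⟨s, hs1, hs⟩ := exists_between hR'1
  have hd : DifferentiableOn ℂ φ (Metric.closedBall 0 R') :=
    hφ.differentiableOn.mono (Metric.closedBall_subset_ball hR')
  lift R' to NNReal using by linarith
  lift s to NNReal using by linarith
  have hp := hd.hasFPowerSeriesOnBall (by exact_mod_cast zero_lt_one.trans hR'1)
  have ht := hp.tendstoUniformlyOn (r' := s) (by exact_mod_cast hs)
  obtain ⟨N, hN⟩ := (Metric.tendstoUniformlyOn_iff.1 ht η hη).exists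
  refine ⟨fun i => ∑ k ∈ Finset.range N, C ((cauchyPowerSeries φ 0 R').coeff k i) * X ^ k,
    fun z hz => ?_⟩
  have := hN z (by
    rw [mem_ball_zero_iff]
    rw [mem_sphere_zero_iff_norm] at hz
    rw [hz]; exact hs1)
  rw [zero_add] at this
  convert this using 2
  ext i
  simp only [FormalMultilinearSeries.partialSum, FormalMultilinearSeries.apply_eq_pow_smul_coeff,
    eval_finsetSum, eval_mul, eval_C, eval_pow, eval_X, Finset.sum_apply, Pi.smul_apply, smul_eq_mul,
    mul_comm]

/-- The boundary of an analytic disk is freely homotopic to that of `P + d`, where `P` is a Taylor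
polynomial and `d` is small and generic, and hence transverse to `V`. -/
theorem circleMem_analyticDisk (hf : Squarefree f) (Q : NormalLoops (HypersurfaceCompl f))
    (hQ : ∀ p ∈ regularPoints f, MeridiansMem Q p) {φ : ℂ → Fin n → ℂ} (hφ : IsAnalyticDisk φ)
    (hV : ∀ z ∈ Metric.sphere (0 : ℂ) 1, φ z ∈ (hypersurface f)ᶜ) :
    Q.circleMem (sphereMap (hypersurface f)ᶜ φ hφ.continuousOn_sphere hV) := by
  have hopen : IsOpen (hypersurface f)ᶜ :=
    (isClosed_singleton (x := (0 : ℂ))).preimage (MvPolynomial.continuous_eval f) |>.isOpen_compl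
  obtain ⟨η, η0, hη⟩ := ((isCompact_sphere (0 : ℂ) 1).image_of_continuousOn
    hφ.continuousOn_sphere).exists_thickening_subset_open hopen (Set.image_subset_iff.2 hV)
  obtain ⟨P, hP⟩ := exists_polynomial_approx hφ (half_pos η0)
  obtain ⟨r, hr0, hr⟩ := exists_generic_translate hf P
  let q : MvPolynomial (Fin n) ℂ :=
    MvPolynomial.aeval (fun i => MvPolynomial.C ((P i).eval 0) + MvPolynomial.X i) f
  have hq : ∀ d, MvPolynomial.eval d q = MvPolynomial.eval (fun i => (P i).eval 0 + d i) f := by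
    intro d
    refine (map_aeval_eq_eval (MvPolynomial.eval d) (by simp) _ f).trans ?_
    simp
  have hq0 : q ≠ 0 := fun h => by
    have h1 := hq (fun i => φ 1 i - (P i).eval 0)
    simp only [h, map_zero, add_sub_cancel] at h1
    exact hV 1 (by simp) h1.symm
  obtain ⟨d, hdη, hd⟩ : ∃ d : Fin n → ℂ, (∀ i, ‖d i‖ < η / 2) ∧ MvPolynomial.eval d (r * q) ≠ 0 := by
    by_contra! hcon
    refine mul_ne_zero hr0 hq0 (MvPolynomial.funext_set (fun _ => Metric.ball (0 : ℂ) (η / 2))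
      (fun _ => ?_) fun d hd => ?_)
    · exact infinite_of_mem_nhds 0 (Metric.ball_mem_nhds _ (half_pos η0))
    · rw [map_zero]
      exact hcon d fun i => by simpa using hd i (Set.mem_univ i)
  rw [map_mul, mul_ne_zero_iff, hq] at hd
  let ψ : ℂ → Fin n → ℂ := fun t i => (P i + C (d i)).eval t
  have hψ : Differentiable ℂ ψ := differentiable_pi.2 fun i => (P i + C (d i)).differentiable
  have hclose : ∀ z ∈ Metric.sphere (0 : ℂ) 1, ψ z ∈ Metric.ball (φ z) η := by
    intro z hz
    rw [Metric.mem_ball']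
    refine (dist_triangle _ _ _).trans_lt ((add_lt_add (hP z hz) ?_).trans_eq (add_halves η))
    rw [dist_pi_lt_iff (half_pos η0)]
    intro i
    simpa [ψ, dist_eq_norm] using hdη i
  have hball : ∀ z ∈ Metric.sphere (0 : ℂ) 1, Metric.ball (φ z) η ⊆ (hypersurface f)ᶜ :=
    fun z hz => (Metric.ball_subset_thickening (Set.mem_image_of_mem φ hz) η).trans hη
  have hψS : ∀ z ∈ Metric.sphere (0 : ℂ) 1, ψ z ∈ (hypersurface f)ᶜ :=
    fun z hz => hball z hz (hclose z hz)
  have hψQ : Q.circleMem (sphereMap (hypersurface f)ᶜ ψ hψ.continuous.continuousOn hψS) := by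
    have hF : (fun t => MvPolynomial.eval (ψ t) f) =
        fun t => (MvPolynomial.aeval (fun i => P i + C (d i)) f : ℂ[X]).eval t := by
      ext t; rw [eval_aeval_polynomial]
    refine circleMem_of_simple_zeros Q hQ hψ ?_ hψS fun t ht => ?_
    · intro h
      exact hd.2 (by simpa [ψ, hypersurface] using h)
    · rw [hF, Polynomial.deriv]
      exact hr d hd.1 t ((congrFun hF t).symm.trans ht)
  refine Q.circleMem_of_homotopic ?_ hψQ
  have hsph : ∀ ζ : Circle, (ζ : ℂ) ∈ Metric.sphere (0 : ℂ) 1 := fun ζ =>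
    mem_sphere_zero_iff_norm.2 ζ.norm_coe
  have hline : ∀ x : I × Circle,
      AffineMap.lineMap (φ x.2) (ψ x.2) (x.1 : ℝ) ∈ (hypersurface f)ᶜ := fun x =>
    hball _ (hsph x.2) ((convex_ball _ _).segment_subset (Metric.mem_ball_self η0)
      (hclose _ (hsph x.2)) (lineMap_mem_segment ℝ _ _ x.1.2))
  have hφc : Continuous fun ζ : Circle => φ ζ :=
    hφ.continuousOn_sphere.comp_continuous (by fun_prop) hsph
  have hψc : Continuous fun ζ : Circle => ψ ζ := hψ.continuous.comp (by fun_prop)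
  refine ⟨{ toFun := fun x => ⟨_, hline x⟩, continuous_toFun := Continuous.subtype_mk ?_ _,
            map_zero_left := fun ζ => Subtype.ext (by simp [sphereMap]),
            map_one_left := fun ζ => Subtype.ext (by simp [sphereMap]) }⟩
  simp only [AffineMap.lineMap_apply_module]
  have h3 : Continuous fun x : I × Circle => (x.1 : ℝ) := by fun_prop
  exact ((continuous_const.sub h3).smul (hφc.comp continuous_snd)).add
    (h3.smul (hψc.comp continuous_snd))

end

theorem lemma1 (n : ℕ) (f : MvPolynomial (Fin n) ℂ) (hf : Squarefree f)
    (b : HypersurfaceCompl f)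
    (l : ∀ C : ConnectedComponents (regularPoints f), Meridian f b C)
    (φ : ℂ → Fin n → ℂ) (hφ : IsAnalyticDisk φ)
    (hV : ∀ z : ℂ, ‖z‖ = 1 → φ z ∉ hypersurface f) :
    ∃ c : ConjClasses (FundamentalGroup (HypersurfaceCompl f) b),
      RepresentsConjClass (analyticLoop f φ hφ hV) c ∧
        ∀ g ∈ c.carrier, IsQuasipositive l g := by
  obtain ⟨α⟩ := joined_hypersurfaceCompl b (⟨φ 1, hV 1 (by simp)⟩ : HypersurfaceCompl f)
  refine ⟨_, ⟨α, rfl⟩, fun g hg => ?_⟩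
  rw [ConjClasses.mem_carrier_iff_mk_eq, ConjClasses.mk_eq_mk_iff_isConj] at hg
  obtain ⟨c, rfl⟩ := isConj_iff.1 hg.symm
  have hmem : (quasipositiveLoops l).mem (Path.Homotopic.Quotient.mk (analyticLoop f φ hφ hV)) :=
    circleMem_analyticDisk hf (quasipositiveLoops l)
      (fun p hp => meridiansMem_of_mem_regularPoints _ l (circleMem_quasipositiveLoops_disk l) hp)
      hφ fun z hz => hV z (by simpa using hz)
  have := hmem (c.symm.trans (Path.Homotopic.Quotient.mk α))
  convert this using 1
  rw [FundamentalGroup.mul_def, FundamentalGroup.mul_def, FundamentalGroup.inv_def]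
  simp only [loopClass, Path.Homotopic.Quotient.mk_trans, Path.Homotopic.Quotient.mk_symm,
    Path.Homotopic.Quotient.trans_assoc, Path.Homotopic.Quotient.symm_trans_distrib,
    Path.Homotopic.Quotient.symm_symm]
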